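/- **Setting.** Consider a network of $L$ MIMO links with channels $\mathbf H_{l,k}\in\mathbb C^{R_l\times T_k}$ (from transmitter $k$ to receiver $l$), identity noise covariance, and a coupling matrix $\mathbf\Phi$ with nonnegative entries and zero diagonal (e.g. a $0/1$ matrix). For positive semidefinite inputs $\mathbf\Sigma_{1:L}$ put $$\mathbf\Omega_l=\mathbf I+\sum_k\Phi_{l,k}\mathbf H_{l,k}\mathbf\Sigma_k\mathbf H_{l,k}^\dagger,\qquad \mathcal I_l(\mathbf\Sigma_{1:L})=\log\left|\mathbf I+\mathbf H_{l,l}\mathbf\Sigma_l\mathbf H_{l,l}^\dagger\mathbf\Omega_l^{-1}\right|$$ (natural logarithm), and let $\mathcal R(P)$ be the set of all $\mathbf x\in\mathbb R_+^L$ for which there are $\mathbf\Sigma_{1:L}\succeq0$ with $\sum_l\mathrm{Tr}\,\mathbf\Sigma_l\le P$ and $x_l\le\mathcal I_l(\mathbf\Sigma_{1:L})$ for all $l$. Let $\tilde{\mathbf\Sigma}_l=\sum_{m=1}^{M_l}\tilde p_{l,m}\tilde{\mathbf t}_{l,m}\tilde{\mathbf t}_{l,m}^\dagger$ with $\tilde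 p_{l,m}>0$ and $\|\tilde{\mathbf t}_{l,m}\|=1$ satisfy $\sum_l\mathrm{Tr}\,\tilde{\mathbf\Sigma}_l\le P$, and suppose that the rate vector $[\tilde{\mathcal I}_l]_l=[\mathcal I_l(\tilde{\mathbf\Sigma}_{1:L})]_l$ is a Pareto point of $\mathcal R(P)$ (no other point of $\mathcal R(P)$ is componentwise at least as large) and is not the zero vector. Let $\tilde{\mathbf\Omega}_l$ be the matrices $\mathbf\Omega_l$ of $\tilde{\mathbf\Sigma}_{1:L}$, and let $\tilde{\mathbf r}_{l,m}$ be the MMSE-SIC receive vectors, i.e. the unit vectors $$\tilde{\mathbf r}_{l,m}=\alpha_{l,m}\Big(\sum_{i>m}\tilde p_{l,i}\mathbf H_{l,l}\tilde{\mathbf t}_{l,i}\tilde{\mathbf t}_{l,i}^\dagger\mathbf H_{l,l}^\dagger+\tilde{\mathbf\Omega}_l\Big)^{-1}\mathbf H_{l,l}\tilde{\mathbf t}_{l,m}.$$ Let $\Psi_{l,m}^{k,n}$ be $0$ if $k=l$ and $m\ge n$, $|\tilde{\mathbf r}_{l,m}^\dagger\mathbf H_{l,l}\tilde{\mathbf t}_{l,n}|^2$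 if $k=l$ and $m<n$, and $\Phi_{l,k}|\tilde{\mathbf r}_{l,m}^\dagger\mathbf H_{l,k}\tilde{\mathbf t}_{k,n}|^2$ if $k\ne l$, and let $\mathbf\Psi$ be the matrix with row index $(l,m)$ and column index $(k,n)$. Let $$\tilde\gamma_{l,m}=\frac{\tilde p_{l,m}|\tilde{\mathbf r}_{l,m}^\dagger\mathbf H_{l,l}\tilde{\mathbf t}_{l,m}|^2}{1+\sum_{k,n}\tilde p_{k,n}\Psi_{l,m}^{k,n}}$$ be the stream SINRs, let $\mathbf D$ be the diagonal matrix with entries $\tilde\gamma_{l,m}/|\tilde{\mathbf r}_{l,m}^\dagger\mathbf H_{l,l}\tilde{\mathbf t}_{l,m}|^2$, and define the reverse-link stream powers by $\tilde{\mathbf q}=(\mathbf D^{-1}-\mathbf\Psi^T)^{-1}\mathbf 1$. Put $\tilde{\hat{\mathbf\Sigma}}_l=\sum_m\tilde q_{l,m}\tilde{\mathbf r}_{l,m}\tilde{\mathbf r}_{l,m}^\dagger$ and $\tilde{\hat{\mathbf\Omega}}_l=\mathbf I+\sum_k\Phi_{k,l}\mathbf H_{k,l}^\dagger\tilde{\hat{\mathbf\Sigma}}_k\mathbf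 H_{k,l}$. Fix a link $l$. With $\mathbf A_{k,m}^{(l)}=\Phi_{k,l}\mathbf H_{k,l}^\dagger\tilde{\mathbf r}_{k,m}\tilde{\mathbf r}_{k,m}^\dagger\mathbf H_{k,l}$, consider the problem $$\min_{\mathbf\Sigma_l\succeq0}\mathrm{Tr}(\mathbf\Sigma_l)\quad\text{s.t.}\quad \log\left|\mathbf I+\mathbf H_{l,l}\mathbf\Sigma_l\mathbf H_{l,l}^\dagger\tilde{\mathbf\Omega}_l^{-1}\right|\ge\tilde{\mathcal I}_l,\qquad \mathrm{Tr}(\mathbf\Sigma_l\mathbf A_{k,m}^{(l)})\le\mathrm{Tr}(\tilde{\mathbf\Sigma}_l\mathbf A_{k,m}^{(l)})\quad(k\ne l,\ 1\le m\le M_k),$$ with multipliers $\nu_l\ge0$ of the rate constraint and $\lambda_{k,m}\ge0$ of the interference constraints. Put $\mathbf A_l(\lambda)=\mathbf I+\sum_{k\ne l}\sum_m\lambda_{k,m}\mathbf A_{k,m}^{(l)}$. The dual function $g_l(\lambda,\nu_l)\in[-\infty,\infty)$ is the infimum over $\mathbf\Sigma_l\succeq0$ of the Lagrangian $$\mathrm{Tr}(\mathbf\Sigma_l\mathbf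 A_l(\lambda))-\sum_{k\ne l}\sum_m\lambda_{k,m}\mathrm{Tr}(\tilde{\mathbf\Sigma}_l\mathbf A_{k,m}^{(l)})+\nu_l\tilde{\mathcal I}_l-\nu_l\log\left|\mathbf I+\mathbf H_{l,l}\mathbf\Sigma_l\mathbf H_{l,l}^\dagger\tilde{\mathbf\Omega}_l^{-1}\right|,$$ and optimal dual variables are nonnegative $(\lambda,\nu_l)$ that maximize $g_l$ over all nonnegative multipliers. **Theorem.** For every link $l$, $\tilde{\mathbf\Sigma}_l$ is an optimal solution of this problem, and optimal dual variables, with zero duality gap $g_l(\tilde\lambda,\tilde\nu_l)=\mathrm{Tr}(\tilde{\mathbf\Sigma}_l)$, are given by $$\tilde\lambda_{k,m}=\tilde q_{k,m}\ \ (k\ne l,\ 1\le m\le M_k),\qquad \tilde\nu_l=\frac{\tilde q_{l,m}\,\tilde p_{l,m}\,(1+\tilde\gamma_{l,m})\,|\tilde{\mathbf r}_{l,m}^\dagger\mathbf H_{l,l}\tilde{\mathbf t}_{l,m}|^2}{\tilde\gamma_{l,m}^2}\quad\text{for every } m=1,\dots,M_l;$$ in particular the last expression does not depend on $m$. (If $M_l=0$,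 this condition on $\tilde\nu_l$ is empty, and the claim is that some $\tilde\nu_l\ge0$ completes $\tilde\lambda$ to optimal dual variables.) Consequently $\mathbf A_l(\tilde\lambda)=\tilde{\hat{\mathbf\Omega}}_l$. -/

import Mathlib

open Matrix
open scoped ComplexOrder

noncomputable section

/-- A one-hop MIMO interference network with `L` links. Link `k` has `nT k` transmit antennas and
link `l` has `nR l` receive antennas; `H l k` is the channel from transmitter `k` to receiver `l`,
and `Φ l k` is the coupling coefficient of the interference from link `k` to link `l` that remains
after cancellation. The noise covariance is the identity. -/
structure BMAC (L : ℕ) where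
  nT : Fin L → ℕ
  nR : Fin L → ℕ
  H : ∀ l k : Fin L, Matrix (Fin (nR l)) (Fin (nT k)) ℂ
  Φ : Matrix (Fin L) (Fin L) ℝ
  Φ_nonneg : ∀ l k, 0 ≤ Φ l k
  Φ_diag : ∀ l, Φ l l = 0

namespace BMAC

variable {L : ℕ} (N : BMAC L)

/-- A family of transmit covariance matrices of the forward links. -/
abbrev Cov : Type := ∀ l : Fin L, Matrix (Fin (N.nT l)) (Fin (N.nT l)) ℂ

/-- A family of transmit covariance matrices of the reverse links. -/
abbrev RevCov : Type := ∀ l : Fin L, Matrix (Fin (N.nR l)) (Fin (N.nR l)) ℂ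

/-- Interference-plus-noise covariance `Ω_l` of forward link `l`. -/
def Omega (S : N.Cov) (l : Fin L) : Matrix (Fin (N.nR l)) (Fin (N.nR l)) ℂ :=
  1 + ∑ k, (N.Φ l k : ℂ) • (N.H l k * S k * (N.H l k)ᴴ)

/-- Interference-plus-noise covariance `Ω̂_l` of reverse link `l` (channels are conjugate-transposed
and the coupling matrix is transposed). -/
def revOmega (S : N.RevCov) (l : Fin L) : Matrix (Fin (N.nT l)) (Fin (N.nT l)) ℂ :=
  1 + ∑ k, (N.Φ k l : ℂ) • ((N.H k l)ᴴ * S k * N.H k l)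

/-- `log |I + H_{l,l} X H_{l,l}† W⁻¹|`: the rate of link `l` when its input covariance is `X` and
its interference-plus-noise covariance is `W`. -/
def linkRate (l : Fin L) (X : Matrix (Fin (N.nT l)) (Fin (N.nT l)) ℂ)
    (W : Matrix (Fin (N.nR l)) (Fin (N.nR l)) ℂ) : ℝ :=
  Real.log (1 + N.H l l * X * (N.H l l)ᴴ * W⁻¹).det.re

/-- Mutual information of link `l`. -/
def rate (S : N.Cov) (l : Fin L) : ℝ := N.linkRate l (S l) (N.Omega S l)

/-- The achievable rate region under the sum power constraint `P`. -/
def rateRegion (P : ℝ) : Set (Fin L → ℝ) :=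
  {x | (∀ l, 0 ≤ x l) ∧ ∃ S : N.Cov, (∀ l, (S l).PosSemidef) ∧
    ∑ l, (S l).trace.re ≤ P ∧ ∀ l, x l ≤ N.rate S l}

/-- The family `S` is Pareto optimal for the sum power `P`: it consists of positive semidefinite
matrices of total power at most `P`, and its rate vector is a maximal element of the region for
the componentwise order. -/
def IsParetoOptimal (P : ℝ) (S : N.Cov) : Prop :=
  (∀ l, (S l).PosSemidef) ∧ ∑ l, (S l).trace.re ≤ P ∧
    Maximal (fun x => x ∈ N.rateRegion P) (N.rate S)

section Streams

variable {M : Fin L → ℕ}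

/-- The covariance matrices `∑_m p_{l,m} t_{l,m} t_{l,m}†`. -/
def cov (p : ∀ l, Fin (M l) → ℝ) (t : ∀ l, Fin (M l) → Fin (N.nT l) → ℂ) : N.Cov :=
  fun l => ∑ m, (p l m : ℂ) • vecMulVec (t l m) (star (t l m))

/-- The reverse covariance matrices `∑_m q_{l,m} r_{l,m} r_{l,m}†`. -/
def revCov (q : ∀ l, Fin (M l) → ℝ) (r : ∀ l, Fin (M l) → Fin (N.nR l) → ℂ) : N.RevCov :=
  fun l => ∑ m, (q l m : ℂ) • vecMulVec (r l m) (star (r l m))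

/-- The unnormalized MMSE-SIC filter of stream `m` of link `l`, where stream `m` is the `m`-th to
be decoded and cancelled. -/
def mmseFilter (p : ∀ l, Fin (M l) → ℝ) (t : ∀ l, Fin (M l) → Fin (N.nT l) → ℂ)
    (l : Fin L) (m : Fin (M l)) : Fin (N.nR l) → ℂ :=
  ((∑ i ∈ Finset.Ioi m,
      (p l i : ℂ) • (N.H l l * vecMulVec (t l i) (star (t l i)) * (N.H l l)ᴴ)) +
    N.Omega (N.cov p t) l)⁻¹ *ᵥ (N.H l l *ᵥ t l m)

/-- The vectors `r` are the normalized MMSE-SIC receive vectors: each is a scalar multiple of the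
MMSE-SIC filter, of Euclidean norm one (as soon as the filter does not vanish). -/
def IsMMSEReceiver (p : ∀ l, Fin (M l) → ℝ) (t : ∀ l, Fin (M l) → Fin (N.nT l) → ℂ)
    (r : ∀ l, Fin (M l) → Fin (N.nR l) → ℂ) : Prop :=
  ∀ l m, ∃ α : ℂ, r l m = α • N.mmseFilter p t l m ∧
    (N.mmseFilter p t l m ≠ 0 → ‖WithLp.toLp 2 (r l m)‖ = 1)

/-- `|r_{l,m}† H_{l,k} t_{k,n}|²`. -/
def gain (t : ∀ l, Fin (M l) → Fin (N.nT l) → ℂ) (r : ∀ l, Fin (M l) → Fin (N.nR l) → ℂ)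
    (l : Fin L) (m : Fin (M l)) (k : Fin L) (n : Fin (M k)) : ℝ :=
  ‖star (r l m) ⬝ᵥ (N.H l k *ᵥ t k n)‖ ^ 2

/-- The cross-talk matrix `Ψ`. The row is the stream that suffers the interference, the column is
the stream that causes it. -/
def crossTalk (t : ∀ l, Fin (M l) → Fin (N.nT l) → ℂ) (r : ∀ l, Fin (M l) → Fin (N.nR l) → ℂ) :
    Matrix (Σ l, Fin (M l)) (Σ l, Fin (M l)) ℝ :=
  Matrix.of fun s u =>
    if u.1 = s.1 then
      (if (u.2 : ℕ) ≤ (s.2 : ℕ) then 0 else N.gain t r s.1 s.2 u.1 u.2)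
    else N.Φ s.1 u.1 * N.gain t r s.1 s.2 u.1 u.2

/-- The SINR of stream `m` of forward link `l`. -/
def sinr (p : ∀ l, Fin (M l) → ℝ) (t : ∀ l, Fin (M l) → Fin (N.nT l) → ℂ)
    (r : ∀ l, Fin (M l) → Fin (N.nR l) → ℂ) (l : Fin L) (m : Fin (M l)) : ℝ :=
  p l m * N.gain t r l m l m /
    (1 + ∑ k, ∑ n, p k n * N.crossTalk t r ⟨l, m⟩ ⟨k, n⟩)

/-- The diagonal matrix with entries `γ_{l,m} / |r_{l,m}† H_{l,l} t_{l,m}|²`. -/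
def sinrDiag (t : ∀ l, Fin (M l) → Fin (N.nT l) → ℂ) (r : ∀ l, Fin (M l) → Fin (N.nR l) → ℂ)
    (γ : ∀ l, Fin (M l) → ℝ) : Matrix (Σ l, Fin (M l)) (Σ l, Fin (M l)) ℝ :=
  Matrix.diagonal fun s => γ s.1 s.2 / N.gain t r s.1 s.2 s.1 s.2

/-- The reverse-link powers `(D⁻¹ - Ψᵀ)⁻¹ 1`, where `D` is built from the forward SINRs. -/
def revPower (p : ∀ l, Fin (M l) → ℝ) (t : ∀ l, Fin (M l) → Fin (N.nT l) → ℂ)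
    (r : ∀ l, Fin (M l) → Fin (N.nR l) → ℂ) (l : Fin L) (m : Fin (M l)) : ℝ :=
  (((N.sinrDiag t r (N.sinr p t r))⁻¹ - (N.crossTalk t r)ᵀ)⁻¹ *ᵥ fun _ => (1 : ℝ)) ⟨l, m⟩

/-! ### The power minimization problem of a single link -/

/-- `A_{k,m}^{(l)} = Φ_{k,l} H_{k,l}† r_{k,m} r_{k,m}† H_{k,l}`. -/
def interfMatrix (r : ∀ l, Fin (M l) → Fin (N.nR l) → ℂ) (l k : Fin L) (m : Fin (M k)) :
    Matrix (Fin (N.nT l)) (Fin (N.nT l)) ℂ :=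
  (N.Φ k l : ℂ) • ((N.H k l)ᴴ * vecMulVec (r k m) (star (r k m)) * N.H k l)

/-- Multipliers `[λ_{k,m}]_{k ≠ l}` of the interference constraints of link `l`. -/
abbrev Mult (M : Fin L → ℕ) (l : Fin L) : Type := ∀ k : {k : Fin L // k ≠ l}, Fin (M k.1) → ℝ

/-- `A_l(λ) = I + ∑_{k ≠ l} ∑_m λ_{k,m} A_{k,m}^{(l)}`. -/
def A (r : ∀ l, Fin (M l) → Fin (N.nR l) → ℂ) (l : Fin L) (lam : Mult M l) :
    Matrix (Fin (N.nT l)) (Fin (N.nT l)) ℂ :=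
  1 + ∑ k : {k : Fin L // k ≠ l}, ∑ m, (lam k m : ℂ) • N.interfMatrix r l k.1 m

/-- The feasible set of the problem of link `l`: minimize `Tr X` over positive semidefinite `X`
such that the rate of link `l` is at least its rate under `S`, and the interference power caused
to each stream of every other link is at most that caused by `S l`. -/
def feasible (S : N.Cov) (r : ∀ l, Fin (M l) → Fin (N.nR l) → ℂ) (l : Fin L) :
    Set (Matrix (Fin (N.nT l)) (Fin (N.nT l)) ℂ) :=
  {X | X.PosSemidef ∧ N.rate S l ≤ N.linkRate l X (N.Omega S l) ∧
    ∀ k : {k : Fin L // k ≠ l}, ∀ m : Fin (M k.1),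
      (X * N.interfMatrix r l k.1 m).trace.re ≤ (S l * N.interfMatrix r l k.1 m).trace.re}

/-- The Lagrangian of the problem of link `l`; positive semidefiniteness of `X` is kept as a
constraint. -/
def lagrangian (S : N.Cov) (r : ∀ l, Fin (M l) → Fin (N.nR l) → ℂ) (l : Fin L)
    (lam : Mult M l) (ν : ℝ) (X : Matrix (Fin (N.nT l)) (Fin (N.nT l)) ℂ) : ℝ :=
  (X * N.A r l lam).trace.re
    - ∑ k : {k : Fin L // k ≠ l}, ∑ m, lam k m * (S l * N.interfMatrix r l k.1 m).trace.re
    + ν * N.rate S l - ν * N.linkRate l X (N.Omega S l)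

/-- The Lagrange dual function, the infimum of the Lagrangian over positive semidefinite `X`. -/
def dualFunction (S : N.Cov) (r : ∀ l, Fin (M l) → Fin (N.nR l) → ℂ) (l : Fin L)
    (lam : Mult M l) (ν : ℝ) : EReal :=
  ⨅ X : {X : Matrix (Fin (N.nT l)) (Fin (N.nT l)) ℂ // X.PosSemidef},
    (N.lagrangian S r l lam ν X.1 : EReal)

/-- `(λ, ν)` are optimal dual variables: they are nonnegative and maximize the dual function among
all nonnegative multipliers. -/
def IsOptimalDual (S : N.Cov) (r : ∀ l, Fin (M l) → Fin (N.nR l) → ℂ) (l : Fin L)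
    (lam : Mult M l) (ν : ℝ) : Prop :=
  (∀ k m, 0 ≤ lam k m) ∧ 0 ≤ ν ∧
    ∀ (lam' : Mult M l) (ν' : ℝ), (∀ k m, 0 ≤ lam' k m) → 0 ≤ ν' →
      N.dualFunction S r l lam' ν' ≤ N.dualFunction S r l lam ν

end Streams

end BMAC

end

/-!
The argument rests on one fact about Pareto points: a Pareto optimal family with a positive rate
uses the least total power among all families that achieve its rates
(`BMAC.IsParetoOptimal.power_le`). Otherwise spare power could be spent by scaling all covariances,
which scales signal and interference but not the noise and so raises every positive rate.

Rates are compared stream by stream. Successive decoding with MMSE receivers attains the mutual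
information, and with any other receivers it achieves at most that (`BMAC.rate_eq_sum`,
`BMAC.sum_log_sinr_le_rate`). So if a perturbed family keeps the SINRs behind the old receivers `r`,
it keeps the rates, and by minimality it cannot use less power. Three perturbations are used.

* Dropping a stream `t` with `H t = 0` would save power. Hence no such stream exists, and all gains
  and SINRs are positive.
* Replacing the covariance of one link by a feasible point of its problem keeps all rates. Hence the
  covariance is optimal for that problem (`BMAC.IsPowerMinimal.trace_le_of_mem_feasible`).
* Adding to link `l` a new beam `x` of small power, decoded first, allows some stream `m` of that
  link a smaller SINR, while the remaining powers move so as to keep all other SINRs. The powers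
  solve a linear system `(D⁻¹ - Ψ) p = 1` with inverse-nonnegative matrix, and the reverse powers
  `q = (D⁻¹ - Ψᵀ)⁻¹ 1` are the sensitivities of the total power to the noise at the streams. To
  first order, minimality of the power therefore says `ν_m H†(Ω + H Σ H†)⁻¹ H ≤ Ω̂` as quadratic
  forms, where `ν_m` is the price of rate at stream `m`
  (`BMAC.IsPowerMinimal.ratePrice_mul_le`).

The Sherman–Morrison formula, telescoped along the decoding order, evaluates the reverse SINR
equations on the beams in use. Against the bound for the largest `ν_m` they force all `ν_m` of a
link to be equal, and they give equality in the bound on these beams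
(`BMAC.IsPowerMinimal.exists_price`). These are the optimality conditions of the Lagrangian with
multipliers `q` and `ν`. By concavity of `log det` they are sufficient, so the dual function at
`(q, ν)` equals `Tr Σ`. Since all constraints are tight at `Σ`, the dual function never exceeds
`Tr Σ`, and the multipliers are optimal.
-/

namespace BMAC

/-! ### Quadratic forms and rank-one updates of Hermitian matrices -/

section Matrices

variable {ι κ : Type*} [Fintype ι] [Fintype κ]

/-- The real part of the quadratic form `v† A v`. -/
noncomputable def qf (A : Matrix ι ι ℂ) (v : ι → ℂ) : ℝ := (star v ⬝ᵥ (A *ᵥ v)).re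

lemma qf_add (A B : Matrix ι ι ℂ) (v : ι → ℂ) : qf (A + B) v = qf A v + qf B v := by
  simp [qf, add_mulVec, dotProduct_add]

lemma qf_sub (A B : Matrix ι ι ℂ) (v : ι → ℂ) : qf (A - B) v = qf A v - qf B v := by
  simp [qf, sub_mulVec, dotProduct_sub]

lemma qf_smul (c : ℝ) (A : Matrix ι ι ℂ) (v : ι → ℂ) : qf ((c : ℂ) • A) v = c * qf A v := by
  simp [qf, smul_mulVec, dotProduct_smul]

lemma qf_sum {σ : Type*} (s : Finset σ) (A : σ → Matrix ι ι ℂ) (v : ι → ℂ) :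
    qf (∑ i ∈ s, A i) v = ∑ i ∈ s, qf (A i) v := by
  simp [qf, sum_mulVec, dotProduct_sum]

lemma qf_zero_right (A : Matrix ι ι ℂ) : qf A 0 = 0 := by simp [qf]

lemma qf_zero_left (v : ι → ℂ) : qf (0 : Matrix ι ι ℂ) v = 0 := by simp [qf]

lemma qf_one [DecidableEq ι] (v : ι → ℂ) : qf 1 v = ‖WithLp.toLp 2 v‖ ^ 2 := by
  rw [EuclideanSpace.norm_sq_eq]
  simp [qf, dotProduct, ← Complex.normSq_eq_norm_sq, Complex.normSq_apply]

lemma qf_vecMulVec (h v : ι → ℂ) : qf (vecMulVec h (star h)) v = ‖star v ⬝ᵥ h‖ ^ 2 := by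
  have h1 : star h ⬝ᵥ v = star (star v ⬝ᵥ h) := by
    rw [star_dotProduct]
  rw [qf, vecMulVec_mulVec, h1]
  simp only [dotProduct_smul, ← Complex.normSq_eq_norm_sq, Complex.normSq_apply]
  simp [MulOpposite.smul_eq_mul_unop]

lemma qf_conj (B : Matrix κ ι ℂ) (A : Matrix κ κ ℂ) (v : ι → ℂ) :
    qf (Bᴴ * A * B) v = qf A (B *ᵥ v) := by
  simp only [qf, ← mulVec_mulVec, dotProduct_mulVec, star_mulVec]

lemma qf_conj' (B : Matrix ι κ ℂ) (A : Matrix κ κ ℂ) (v : ι → ℂ) :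
    qf (B * A * Bᴴ) v = qf A (Bᴴ *ᵥ v) := by
  have := qf_conj Bᴴ A v
  rwa [conjTranspose_conjTranspose] at this

lemma qf_nonneg {A : Matrix ι ι ℂ} (hA : A.PosSemidef) (v : ι → ℂ) : 0 ≤ qf A v :=
  hA.re_dotProduct_nonneg v

lemma qf_pos {A : Matrix ι ι ℂ} (hA : A.PosDef) {v : ι → ℂ} (hv : v ≠ 0) : 0 < qf A v :=
  hA.re_dotProduct_pos hv

lemma conj_vecMulVec {κ : Type*} (B : Matrix κ ι ℂ) (v : ι → ℂ) :
    B * vecMulVec v (star v) * Bᴴ = vecMulVec (B *ᵥ v) (star (B *ᵥ v)) := by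
  rw [mul_vecMulVec, vecMulVec_mul, star_mulVec]

lemma posSemidef_smul_vecMulVec {c : ℝ} (hc : 0 ≤ c) (v : ι → ℂ) :
    ((c : ℂ) • vecMulVec v (star v)).PosSemidef :=
  (posSemidef_vecMulVec_self_star v).smul (by exact_mod_cast hc)

/-- The quadratic form of a Hermitian matrix is real. -/
lemma dotProduct_mulVec_eq_qf {A : Matrix ι ι ℂ} (hA : A.IsHermitian) (v : ι → ℂ) :
    star v ⬝ᵥ (A *ᵥ v) = (qf A v : ℂ) := by
  have := hA.im_star_dotProduct_mulVec_self v
  apply Complex.ext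
  · simp [qf]
  · simpa using this

lemma star_dotProduct_mulVec {A : Matrix ι ι ℂ} (hA : A.IsHermitian) (u v : ι → ℂ) :
    star u ⬝ᵥ (A *ᵥ v) = star (star v ⬝ᵥ (A *ᵥ u)) := by
  rw [star_dotProduct, star_mulVec, hA.eq, ← dotProduct_mulVec]

lemma trace_vecMulVec_mul (v : ι → ℂ) (A : Matrix ι ι ℂ) :
    (vecMulVec v (star v) * A).trace = star v ⬝ᵥ (A *ᵥ v) := by
  rw [vecMulVec_mul, trace_vecMulVec, dotProduct_comm, dotProduct_mulVec]

lemma trace_vecMulVec_mul_re (v : ι → ℂ) (A : Matrix ι ι ℂ) :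
    (vecMulVec v (star v) * A).trace.re = qf A v := by
  rw [trace_vecMulVec_mul, qf]

/-- A positive semidefinite matrix and a matrix with nonnegative quadratic form have a nonnegative
trace pairing. -/
lemma trace_mul_re_nonneg {X G : Matrix ι ι ℂ} (hX : X.PosSemidef) (hG : ∀ v, 0 ≤ qf G v) :
    0 ≤ (X * G).trace.re := by
  obtain ⟨m, y, rfl⟩ := posSemidef_iff_eq_sum_vecMulVec.mp hX
  rw [Finset.sum_mul, trace_sum, Complex.re_sum]
  exact Finset.sum_nonneg fun i _ => by rw [trace_vecMulVec_mul_re]; exact hG _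

variable [DecidableEq ι]

/-- The Cauchy–Schwarz inequality for the inner product of a positive definite matrix. -/
lemma norm_dotProduct_sq_le {A : Matrix ι ι ℂ} (hA : A.PosDef) (v h : ι → ℂ) :
    ‖star v ⬝ᵥ h‖ ^ 2 ≤ qf A v * qf A⁻¹ h := by
  rcases eq_or_ne h 0 with rfl | hh
  · simp [qf_zero_right]
  have ha : 0 < qf A⁻¹ h := qf_pos hA.inv hh
  set a := qf A⁻¹ h with ha_def
  set z := star v ⬝ᵥ h with hz
  -- The form is nonnegative at `v` minus its projection onto `u = A⁻¹ h`.
  set u := A⁻¹ *ᵥ h with hu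
  have hAu : A *ᵥ u = h := by
    rw [hu, mulVec_mulVec, mul_nonsing_inv _ ((isUnit_iff_isUnit_det _).mp hA.isUnit), one_mulVec]
  have huh : star u ⬝ᵥ h = (a : ℂ) := by
    rw [hu, star_mulVec, hA.inv.isHermitian.eq, ← dotProduct_mulVec,
      dotProduct_mulVec_eq_qf hA.inv.isHermitian]
  have huv : star u ⬝ᵥ (A *ᵥ v) = star z := by
    rw [star_dotProduct_mulVec hA.isHermitian, hAu]
  have key := qf_nonneg hA.posSemidef (v - (star z / a) • u)
  have expand : qf A (v - (star z / a) • u) = qf A v - ‖z‖ ^ 2 / a := by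
    have e : star (v - (star z / a : ℂ) • u) ⬝ᵥ (A *ᵥ (v - (star z / a : ℂ) • u))
        = star v ⬝ᵥ (A *ᵥ v) - z * star z / a := by
      have hac : (a : ℂ) ≠ 0 := by exact_mod_cast ha.ne'
      simp only [mulVec_sub, mulVec_smul, hAu, star_sub, star_smul, sub_dotProduct, dotProduct_sub,
        smul_dotProduct, dotProduct_smul, huh, huv, ← hz, smul_eq_mul]
      simp
      field_simp
      ring
    have e2 : z * star z / a = ((‖z‖ ^ 2 / a : ℝ) : ℂ) := by
      rw [Complex.star_def, Complex.mul_conj, Complex.normSq_eq_norm_sq]; push_cast; rfl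
    rw [qf, e, e2, Complex.sub_re, Complex.ofReal_re, qf]
  rw [expand] at key
  have : ‖z‖ ^ 2 / a ≤ qf A v := by linarith
  rwa [div_le_iff₀ ha] at this

/-- The **Sherman–Morrison formula** for the quadratic form of the inverse. -/
lemma qf_inv_rank_one_update {V : Matrix ι ι ℂ} (hV : V.PosDef) {p : ℝ} (hp : 0 ≤ p)
    (h v : ι → ℂ) :
    qf (V + (p : ℂ) • vecMulVec h (star h))⁻¹ v =
      qf V⁻¹ v - p * ‖star h ⬝ᵥ (V⁻¹ *ᵥ v)‖ ^ 2 / (1 + p * qf V⁻¹ h) := by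
  have hA : (V + (p : ℂ) • vecMulVec h (star h)).PosDef :=
    hV.add_posSemidef (posSemidef_smul_vecMulVec hp h)
  set A := V + (p : ℂ) • vecMulVec h (star h) with hAdef
  have hVu := (isUnit_iff_isUnit_det _).mp hV.isUnit
  have hAu := (isUnit_iff_isUnit_det _).mp hA.isUnit
  set a := qf V⁻¹ h with ha
  have ha0 : 0 ≤ a := qf_nonneg hV.inv.posSemidef h
  set z := star h ⬝ᵥ (V⁻¹ *ᵥ v) with hz
  have hd : (1 + p * a : ℂ) ≠ 0 := by
    have : (0 : ℝ) < 1 + p * a := by positivity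
    exact_mod_cast this.ne'
  have hsol : A⁻¹ *ᵥ v = V⁻¹ *ᵥ v - (p * z / (1 + p * a) : ℂ) • (V⁻¹ *ᵥ h) := by
    have : A *ᵥ (V⁻¹ *ᵥ v - (p * z / (1 + p * a) : ℂ) • (V⁻¹ *ᵥ h)) = v := by
      have e1 : ∀ w, V *ᵥ (V⁻¹ *ᵥ w) = w := fun w => by
        rw [mulVec_mulVec, mul_nonsing_inv _ hVu, one_mulVec]
      have e2 : star h ⬝ᵥ (V⁻¹ *ᵥ h) = (a : ℂ) := dotProduct_mulVec_eq_qf hV.inv.isHermitian h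
      rw [hAdef, add_mulVec, mulVec_sub, mulVec_smul, e1, e1, smul_mulVec, vecMulVec_mulVec,
        dotProduct_sub, dotProduct_smul, e2, ← hz]
      ext i
      simp [MulOpposite.smul_eq_mul_unop]
      field_simp
      ring
    calc A⁻¹ *ᵥ v = A⁻¹ *ᵥ (A *ᵥ (V⁻¹ *ᵥ v - (p * z / (1 + p * a) : ℂ) • (V⁻¹ *ᵥ h))) := by
          rw [this]
      _ = _ := by rw [mulVec_mulVec, nonsing_inv_mul _ hAu, one_mulVec]
  have e3 : star v ⬝ᵥ (V⁻¹ *ᵥ h) = star z := star_dotProduct_mulVec hV.inv.isHermitian _ _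
  have e4 : (p * z / (1 + p * a) : ℂ) * star z = ((p * ‖z‖ ^ 2 / (1 + p * a) : ℝ) : ℂ) := by
    have : z * star z = ((‖z‖ ^ 2 : ℝ) : ℂ) := by
      rw [Complex.star_def, Complex.mul_conj, Complex.normSq_eq_norm_sq]
    push_cast at this ⊢
    rw [← this]; ring
  rw [qf, hsol, dotProduct_sub, dotProduct_smul, e3, smul_eq_mul, e4, Complex.sub_re,
    Complex.ofReal_re, qf]

/-- The logarithm of the real part of the determinant, to be used for positive definite matrices,
whose determinant is a positive real. -/
noncomputable def logDet (A : Matrix ι ι ℂ) : ℝ := Real.log A.det.re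

lemma det_eq_re {A : Matrix ι ι ℂ} (hA : A.PosDef) : A.det = (A.det.re : ℂ) := by
  have := hA.det_pos
  exact (Complex.ext rfl (by simpa using (Complex.lt_def.mp this).2.symm))

lemma det_re_pos {A : Matrix ι ι ℂ} (hA : A.PosDef) : 0 < A.det.re :=
  (Complex.lt_def.mp hA.det_pos).1

lemma logDet_rank_one_update {V : Matrix ι ι ℂ} (hV : V.PosDef) {p : ℝ} (hp : 0 ≤ p)
    (h : ι → ℂ) :
    logDet (V + (p : ℂ) • vecMulVec h (star h)) = logDet V + Real.log (1 + p * qf V⁻¹ h) := by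
  have hVu := (isUnit_iff_isUnit_det _).mp hV.isUnit
  have e : (V + (p : ℂ) • vecMulVec h (star h)).det =
      ((V.det.re * (1 + p * qf V⁻¹ h) : ℝ) : ℂ) := by
    have e1 : V + (p : ℂ) • vecMulVec h (star h) =
        V + replicateCol Unit ((p : ℂ) • h) * replicateRow Unit (star h) := by
      rw [← vecMulVec_eq Unit, smul_vecMulVec]
    rw [e1, det_add_replicateCol_mul_replicateRow (ι := Unit) hVu, det_eq_re hV,
      det_unique (n := Unit), ← replicateRow_vecMul, Matrix.add_apply,
      replicateRow_mul_replicateCol_apply, ← dotProduct_mulVec, mulVec_smul,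
      dotProduct_smul, dotProduct_mulVec_eq_qf hV.inv.isHermitian]
    simp
  rw [logDet, e, Complex.ofReal_re, Real.log_mul (det_re_pos hV).ne', logDet]
  have := qf_nonneg hV.inv.posSemidef h
  positivity

lemma logDet_le_trace_sub_card {Z : Matrix ι ι ℂ} (hZ : Z.PosDef) :
    logDet Z ≤ Z.trace.re - Fintype.card ι := by
  have h1 : Z.det.re = ∏ i, hZ.isHermitian.eigenvalues i := by
    rw [hZ.isHermitian.det_eq_prod_eigenvalues]
    have : (∏ i, (hZ.isHermitian.eigenvalues i : ℂ)) =
      ((∏ i, hZ.isHermitian.eigenvalues i : ℝ) : ℂ) := by push_cast; rfl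
    exact (congrArg Complex.re this).trans (Complex.ofReal_re _)
  have h2 : Z.trace.re = ∑ i, hZ.isHermitian.eigenvalues i := by
    rw [hZ.isHermitian.trace_eq_sum_eigenvalues]
    simp
  rw [logDet, h1, h2, Real.log_prod fun i _ => (hZ.eigenvalues_pos i).ne']
  calc _ ≤ ∑ i, (hZ.isHermitian.eigenvalues i - 1) :=
        Finset.sum_le_sum fun i _ => Real.log_le_sub_one_of_pos (hZ.eigenvalues_pos i)
    _ = _ := by simp

open scoped MatrixOrder Matrix.Norms.L2Operator in
/-- Concavity of `logDet` in its first-order form. -/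
lemma logDet_le_add_trace {Z V : Matrix ι ι ℂ} (hZ : Z.PosDef) (hV : V.PosDef) :
    logDet Z ≤ logDet V + ((Z - V) * V⁻¹).trace.re := by
  have hVu := (isUnit_iff_isUnit_det _).mp hV.isUnit
  obtain ⟨B, hB⟩ := CStarAlgebra.nonneg_iff_eq_star_mul_self.mp hV.inv.posSemidef.nonneg
  rw [star_eq_conjTranspose] at hB
  -- With `V⁻¹ = B† B` the claim is `log det ≤ Tr - n` for the matrix `B Z B†`.
  have hBu : IsUnit B := by
    have h1 := hV.inv.isUnit
    rw [isUnit_iff_isUnit_det, hB, det_mul] at h1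
    exact (isUnit_iff_isUnit_det _).mpr (isUnit_of_mul_isUnit_right h1)
  have hM : (B * Z * Bᴴ).PosDef :=
    hZ.mul_mul_conjTranspose_same (vecMul_injective_of_isUnit hBu)
  have htr : ((Z - V) * V⁻¹).trace = (B * Z * Bᴴ).trace - Fintype.card ι := by
    rw [sub_mul, trace_sub, mul_nonsing_inv _ hVu, trace_one, hB, ← Matrix.mul_assoc,
      trace_mul_comm, ← Matrix.mul_assoc]
  have hdet : (B * Z * Bᴴ).det.re = Z.det.re * V.det.re⁻¹ := by
    have h1 : (B * Z * Bᴴ).det = Z.det * V⁻¹.det := by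
      rw [hB, det_mul, det_mul, det_mul]; ring
    rw [h1, det_nonsing_inv, Ring.inverse_eq_inv', det_eq_re hZ, det_eq_re hV,
      ← Complex.ofReal_inv, ← Complex.ofReal_mul, Complex.ofReal_re, Complex.ofReal_re,
      Complex.ofReal_re]
  have hlog : logDet (B * Z * Bᴴ) = logDet Z - logDet V := by
    rw [logDet, hdet, Real.log_mul (det_re_pos hZ).ne' (inv_ne_zero (det_re_pos hV).ne'),
      Real.log_inv, logDet, logDet, sub_eq_add_neg]
  have := logDet_le_trace_sub_card hM
  rw [hlog] at this
  rw [htr, Complex.sub_re, Complex.natCast_re]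
  linarith

end Matrices

/-! ### Successive interference cancellation -/

section SIC

variable {ι : Type*}

/-- The covariance seen by stream `m` under successive decoding: the noise `W` together with the
streams that are decoded after `m`. -/
noncomputable def sicNoise {M : ℕ} (W : Matrix ι ι ℂ) (p : Fin M → ℝ) (h : Fin M → ι → ℂ)
    (m : Fin M) : Matrix ι ι ℂ :=
  W + ∑ i ∈ Finset.Ioi m, (p i : ℂ) • vecMulVec (h i) (star (h i))

lemma sicNoise_zero {M : ℕ} (W : Matrix ι ι ℂ) (p : Fin (M + 1) → ℝ) (h : Fin (M + 1) → ι → ℂ) :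
    sicNoise W p h 0 =
      W + ∑ i : Fin M, (p i.succ : ℂ) • vecMulVec (h i.succ) (star (h i.succ)) := by
  rw [sicNoise, Fin.sum_Ioi_zero]

lemma sicNoise_succ {M : ℕ} (W : Matrix ι ι ℂ) (p : Fin (M + 1) → ℝ) (h : Fin (M + 1) → ι → ℂ)
    (m : Fin M) :
    sicNoise W p h m.succ = sicNoise W (fun i => p i.succ) (fun i => h i.succ) m := by
  rw [sicNoise, Fin.sum_Ioi_succ, sicNoise]

lemma add_streams_eq {M : ℕ} (W : Matrix ι ι ℂ) (p : Fin (M + 1) → ℝ) (h : Fin (M + 1) → ι → ℂ) :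
    W + ∑ i, (p i : ℂ) • vecMulVec (h i) (star (h i)) =
      sicNoise W p h 0 + (p 0 : ℂ) • vecMulVec (h 0) (star (h 0)) := by
  rw [sicNoise_zero, Fin.sum_univ_succ]; abel

variable [Fintype ι]

lemma posDef_sicNoise {M : ℕ} {W : Matrix ι ι ℂ} (hW : W.PosDef) {p : Fin M → ℝ}
    (hp : ∀ i, 0 ≤ p i) (h : Fin M → ι → ℂ) (m : Fin M) : (sicNoise W p h m).PosDef :=
  hW.add_posSemidef (posSemidef_sum _ fun i _ => posSemidef_smul_vecMulVec (hp i) _)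

lemma posDef_add_streams {M : ℕ} {W : Matrix ι ι ℂ} (hW : W.PosDef) {p : Fin M → ℝ}
    (hp : ∀ i, 0 ≤ p i) (h : Fin M → ι → ℂ) :
    (W + ∑ i, (p i : ℂ) • vecMulVec (h i) (star (h i))).PosDef :=
  hW.add_posSemidef (posSemidef_sum _ fun i _ => posSemidef_smul_vecMulVec (hp i) _)

variable [DecidableEq ι]

/-- The chain rule: successive decoding with optimal receivers loses no rate. -/
lemma logDet_add_streams {M : ℕ} {W : Matrix ι ι ℂ} (hW : W.PosDef) {p : Fin M → ℝ}
    (hp : ∀ i, 0 ≤ p i) (h : Fin M → ι → ℂ) :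
    logDet (W + ∑ i, (p i : ℂ) • vecMulVec (h i) (star (h i))) =
      logDet W + ∑ m, Real.log (1 + p m * qf (sicNoise W p h m)⁻¹ (h m)) := by
  induction M with
  | zero => simp
  | succ M ih =>
    rw [add_streams_eq, logDet_rank_one_update (posDef_sicNoise hW hp h 0) (hp 0),
      Fin.sum_univ_succ]
    simp only [sicNoise_succ]
    rw [sicNoise_zero, ih (fun i => hp i.succ)]
    ring

/-- The signal-to-noise ratio behind any linear receiver is at most that of the MMSE receiver. -/
lemma sinr_le_mmse {V : Matrix ι ι ℂ} (hV : V.PosDef) {p : ℝ} (hp : 0 ≤ p) (r h : ι → ℂ) :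
    p * ‖star r ⬝ᵥ h‖ ^ 2 / qf V r ≤ p * qf V⁻¹ h := by
  rcases eq_or_ne r 0 with rfl | hr
  -- For `r = 0` the quotient is `0 / 0 = 0`.
  · have := qf_nonneg hV.inv.posSemidef h
    simp only [qf_zero_right, div_zero]; positivity
  · rw [div_le_iff₀ (qf_pos hV hr), mul_assoc]
    refine mul_le_mul_of_nonneg_left ?_ hp
    rw [mul_comm]; exact norm_dotProduct_sq_le hV r h

/-- Linear receivers with successive cancellation achieve at most the mutual information. -/
lemma sum_log_sinr_le {M : ℕ} {W : Matrix ι ι ℂ} (hW : W.PosDef) {p : Fin M → ℝ}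
    (hp : ∀ i, 0 ≤ p i) (h r : Fin M → ι → ℂ) :
    ∑ m, Real.log (1 + p m * ‖star (r m) ⬝ᵥ h m‖ ^ 2 / qf (sicNoise W p h m) (r m)) ≤
      logDet (W + ∑ i, (p i : ℂ) • vecMulVec (h i) (star (h i))) - logDet W := by
  rw [logDet_add_streams hW hp, add_sub_cancel_left]
  refine Finset.sum_le_sum fun m _ => ?_
  have hV := posDef_sicNoise hW hp h m
  have h1 := sinr_le_mmse hV (hp m) (r m) (h m)
  have h2 : 0 ≤ p m * ‖star (r m) ⬝ᵥ h m‖ ^ 2 / qf (sicNoise W p h m) (r m) :=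
    div_nonneg (mul_nonneg (hp m) (by positivity)) (qf_nonneg hV.posSemidef _)
  exact Real.log_le_log (by linarith) (by linarith)

/-- The MMSE receiver `V⁻¹ h` sees the signal with amplitude `h† V⁻¹ v`. -/
lemma norm_star_mmse_dotProduct {V : Matrix ι ι ℂ} (hV : V.PosDef) (α : ℂ) (h v : ι → ℂ) :
    ‖star (α • (V⁻¹ *ᵥ h)) ⬝ᵥ v‖ ^ 2 = ‖α‖ ^ 2 * ‖star h ⬝ᵥ (V⁻¹ *ᵥ v)‖ ^ 2 := by
  rw [star_smul, smul_dotProduct, star_mulVec, hV.inv.isHermitian.eq, ← dotProduct_mulVec,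
    smul_eq_mul, norm_mul, norm_star, mul_pow]

lemma norm_star_mmse_dotProduct_self {V : Matrix ι ι ℂ} (hV : V.PosDef) (α : ℂ) (h : ι → ℂ) :
    ‖star (α • (V⁻¹ *ᵥ h)) ⬝ᵥ h‖ ^ 2 = ‖α‖ ^ 2 * qf V⁻¹ h ^ 2 := by
  rw [norm_star_mmse_dotProduct hV, dotProduct_mulVec_eq_qf hV.inv.isHermitian, Complex.norm_real,
    Real.norm_eq_abs, sq_abs]

lemma qf_mmse {V : Matrix ι ι ℂ} (hV : V.PosDef) (α : ℂ) (h : ι → ℂ) :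
    qf V (α • (V⁻¹ *ᵥ h)) = ‖α‖ ^ 2 * qf V⁻¹ h := by
  have h1 : V *ᵥ (V⁻¹ *ᵥ h) = h := by
    rw [mulVec_mulVec, mul_nonsing_inv _ ((isUnit_iff_isUnit_det _).mp hV.isUnit), one_mulVec]
  have h2 : star (V⁻¹ *ᵥ h) ⬝ᵥ h = (qf V⁻¹ h : ℂ) := by
    rw [star_mulVec, hV.inv.isHermitian.eq, ← dotProduct_mulVec,
      dotProduct_mulVec_eq_qf hV.inv.isHermitian]
  have h3 : star α * α = ((‖α‖ ^ 2 : ℝ) : ℂ) := by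
    rw [Complex.star_def, mul_comm, Complex.mul_conj, Complex.normSq_eq_norm_sq]
  rw [qf, mulVec_smul, h1, star_smul, smul_dotProduct, dotProduct_smul, h2, smul_eq_mul,
    smul_eq_mul, ← mul_assoc, h3, ← Complex.ofReal_mul, Complex.ofReal_re]

/-- The MMSE receiver attains the optimal signal-to-noise ratio. -/
lemma sinr_mmse {V : Matrix ι ι ℂ} (hV : V.PosDef) (p : ℝ) {α : ℂ} {h : ι → ℂ}
    (hα : h ≠ 0 → α ≠ 0) :
    p * ‖star (α • (V⁻¹ *ᵥ h)) ⬝ᵥ h‖ ^ 2 / qf V (α • (V⁻¹ *ᵥ h)) = p * qf V⁻¹ h := by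
  rw [norm_star_mmse_dotProduct_self hV, qf_mmse hV]
  rcases eq_or_ne h 0 with rfl | hh
  · simp [qf_zero_right]
  · have h1 := (qf_pos hV.inv hh).ne'
    have h2 : ‖α‖ ≠ 0 := norm_ne_zero_iff.mpr (hα hh)
    field_simp

/-- The Sherman–Morrison formula telescoped over the streams decoded up to stage `m`. -/
lemma qf_inv_telescope {M : ℕ} {W : Matrix ι ι ℂ} (hW : W.PosDef) {p : Fin M → ℝ}
    (hp : ∀ i, 0 ≤ p i) (h : Fin M → ι → ℂ) (v : ι → ℂ) (m : Fin M) :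
    qf (sicNoise W p h m)⁻¹ v =
      qf (W + ∑ i, (p i : ℂ) • vecMulVec (h i) (star (h i)))⁻¹ v +
        ∑ n ∈ Finset.Iic m, p n * ‖star (h n) ⬝ᵥ ((sicNoise W p h n)⁻¹ *ᵥ v)‖ ^ 2 /
          (1 + p n * qf (sicNoise W p h n)⁻¹ (h n)) := by
  induction M with
  | zero => exact m.elim0
  | succ M ih =>
    rw [add_streams_eq, qf_inv_rank_one_update (posDef_sicNoise hW hp h 0) (hp 0)]
    refine Fin.cases ?_ (fun m => ?_) m
    · have : Finset.Iic (0 : Fin (M + 1)) = {0} := by ext i; simp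
      rw [this, Finset.sum_singleton]; ring
    · have : Finset.Iic m.succ = insert 0 ((Finset.Iic m).map (Fin.succEmb M)) := by
        ext i; refine Fin.cases ?_ (fun i => ?_) i <;> simp
      rw [this, Finset.sum_insert (by simp), Finset.sum_map]
      simp only [Fin.coe_succEmb, sicNoise_succ]
      rw [ih (fun i => hp i.succ), sicNoise_zero]
      ring

end SIC

/-! ### Nonnegative inverses -/

section MMatrix

variable {σ : Type*} [Fintype σ] [DecidableEq σ] {d p : σ → ℝ} {Ψ : Matrix σ σ ℝ}

/-- `D - Ψ` with `Ψ ≥ 0` is inverse-monotone if it maps some positive vector to the vector of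
ones. -/
lemma nonneg_of_mulVec_nonneg (hΨ : ∀ s u, 0 ≤ Ψ s u) (hp : ∀ s, 0 < p s)
    (hB : (diagonal d - Ψ) *ᵥ p = fun _ => 1) {v : σ → ℝ}
    (hv : ∀ s, 0 ≤ ((diagonal d - Ψ) *ᵥ v) s) (s : σ) : 0 ≤ v s := by
  have : Nonempty σ := ⟨s⟩
  -- Otherwise the row in which `v / p` is least has a negative image.
  obtain ⟨u, hu⟩ := Finite.exists_min fun s => v s / p s
  by_contra hs
  push Not at hs
  have hneg : v u / p u < 0 := (hu s).trans_lt (div_neg_of_neg_of_pos hs (hp s))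
  set θ := v u / p u with hθ
  have hvθ : ∀ w, θ * p w ≤ v w := fun w => (le_div_iff₀ (hp w)).mp (hu w)
  have hvu : v u = θ * p u := by rw [hθ]; field_simp [(hp u).ne']
  have h1 := hv u
  have h2 := congrFun hB u
  simp only [sub_mulVec, mulVec_diagonal, Pi.sub_apply] at h1 h2
  have h3 : θ * (Ψ *ᵥ p) u ≤ (Ψ *ᵥ v) u := by
    simp only [mulVec, dotProduct, Finset.mul_sum]
    exact Finset.sum_le_sum fun w _ => by nlinarith [hvθ w, hΨ u w]
  rw [hvu] at h1
  nlinarith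

lemma isUnit_det_of_mulVec_eq_one (hΨ : ∀ s u, 0 ≤ Ψ s u) (hp : ∀ s, 0 < p s)
    (hB : (diagonal d - Ψ) *ᵥ p = fun _ => 1) : IsUnit (diagonal d - Ψ).det := by
  rw [isUnit_iff_ne_zero]
  intro h0
  obtain ⟨v, hv0, hv⟩ := exists_mulVec_eq_zero_iff.mpr h0
  refine hv0 (funext fun s => le_antisymm ?_ ?_)
  · have := nonneg_of_mulVec_nonneg hΨ hp hB (v := -v) (fun s => by simp [mulVec_neg, hv]) s
    simpa using this
  · exact nonneg_of_mulVec_nonneg hΨ hp hB (fun s => by simp [hv]) s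

/-- The dual powers `(D - Ψᵀ)⁻¹ 1` solve the reverse-link equations and are nonnegative. -/
lemma dualPower_spec (hΨ : ∀ s u, 0 ≤ Ψ s u) (hp : ∀ s, 0 < p s)
    (hB : (diagonal d - Ψ) *ᵥ p = fun _ => 1) :
    (diagonal d - Ψᵀ) *ᵥ ((diagonal d - Ψᵀ)⁻¹ *ᵥ fun _ => 1) = (fun _ => 1) ∧
      ∀ s, 0 ≤ ((diagonal d - Ψᵀ)⁻¹ *ᵥ fun _ => 1) s := by
  have hu := isUnit_det_of_mulVec_eq_one hΨ hp hB
  have htr : diagonal d - Ψᵀ = (diagonal d - Ψ)ᵀ := by simp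
  constructor
  · rw [mulVec_mulVec, mul_nonsing_inv, one_mulVec]
    rwa [htr, det_transpose]
  · intro s
    rw [htr, ← transpose_nonsing_inv, mulVec_transpose]
    have h1 : ∀ u, 0 ≤ ((diagonal d - Ψ)⁻¹ *ᵥ Pi.single s 1) u := fun u => by
      refine nonneg_of_mulVec_nonneg hΨ hp hB (fun w => ?_) u
      rw [mulVec_mulVec, mul_nonsing_inv _ hu, one_mulVec]
      exact (Pi.single_nonneg.mpr (zero_le_one (α := ℝ)) : (0 : σ → ℝ) ≤ Pi.single s 1) w
    simp only [vecMul, dotProduct, one_mul]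
    exact Finset.sum_nonneg fun u _ => by simpa using h1 u

end MMatrix

/-! ### Rates of the network -/

section Network

variable {L : ℕ} (N : BMAC L)

lemma posDef_Omega {S : N.Cov} (hS : ∀ k, (S k).PosSemidef) (l : Fin L) : (N.Omega S l).PosDef :=
  PosDef.one.add_posSemidef <| posSemidef_sum _ fun k _ =>
    ((hS k).mul_mul_conjTranspose_same _).smul (by exact_mod_cast N.Φ_nonneg l k)

lemma linkRate_eq (l : Fin L) {X : Matrix (Fin (N.nT l)) (Fin (N.nT l)) ℂ} (hX : X.PosSemidef)
    {W : Matrix (Fin (N.nR l)) (Fin (N.nR l)) ℂ} (hW : W.PosDef) :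
    N.linkRate l X W = logDet (W + N.H l l * X * (N.H l l)ᴴ) - logDet W := by
  have hA : (W + N.H l l * X * (N.H l l)ᴴ).PosDef :=
    hW.add_posSemidef (hX.mul_mul_conjTranspose_same _)
  have hWu := (isUnit_iff_isUnit_det _).mp hW.isUnit
  have h1 : 1 + N.H l l * X * (N.H l l)ᴴ * W⁻¹ = (W + N.H l l * X * (N.H l l)ᴴ) * W⁻¹ := by
    rw [add_mul, mul_nonsing_inv _ hWu]
  rw [linkRate, h1, det_mul, det_nonsing_inv, Ring.inverse_eq_inv', det_eq_re hA, det_eq_re hW,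
    ← Complex.ofReal_inv, ← Complex.ofReal_mul, Complex.ofReal_re,
    Real.log_mul (det_re_pos hA).ne' (inv_ne_zero (det_re_pos hW).ne'), Real.log_inv,
    ← sub_eq_add_neg, logDet, logDet]

lemma conj_streams {m : ℕ} (l k : Fin L) (p : Fin m → ℝ) (y : Fin m → Fin (N.nT k) → ℂ) :
    N.H l k * (∑ i, (p i : ℂ) • vecMulVec (y i) (star (y i))) * (N.H l k)ᴴ =
      ∑ i, (p i : ℂ) • vecMulVec (N.H l k *ᵥ y i) (star (N.H l k *ᵥ y i)) := by
  simp only [Matrix.mul_sum, Matrix.sum_mul, Matrix.mul_smul, Matrix.smul_mul, conj_vecMulVec]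

/-- The rate of a link split over the streams of its input covariance. -/
lemma rate_eq_sum {S : N.Cov} (hS : ∀ k, (S k).PosSemidef) (l : Fin L) {m : ℕ} {p : Fin m → ℝ}
    (hp : ∀ i, 0 ≤ p i) {y : Fin m → Fin (N.nT l) → ℂ}
    (hSl : S l = ∑ i, (p i : ℂ) • vecMulVec (y i) (star (y i))) :
    N.rate S l = ∑ i, Real.log (1 + p i *
      qf (sicNoise (N.Omega S l) p (fun i => N.H l l *ᵥ y i) i)⁻¹ (N.H l l *ᵥ y i)) := by
  rw [rate, linkRate_eq _ _ (hS l) (posDef_Omega N hS l), hSl, conj_streams,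
    logDet_add_streams (posDef_Omega N hS l) hp, add_sub_cancel_left]

lemma sum_log_sinr_le_rate {S : N.Cov} (hS : ∀ k, (S k).PosSemidef) (l : Fin L) {m : ℕ}
    {p : Fin m → ℝ} (hp : ∀ i, 0 ≤ p i) {y : Fin m → Fin (N.nT l) → ℂ}
    (hSl : S l = ∑ i, (p i : ℂ) • vecMulVec (y i) (star (y i))) (r : Fin m → Fin (N.nR l) → ℂ) :
    ∑ i, Real.log (1 + p i * ‖star (r i) ⬝ᵥ (N.H l l *ᵥ y i)‖ ^ 2 /
      qf (sicNoise (N.Omega S l) p (fun i => N.H l l *ᵥ y i) i) (r i)) ≤ N.rate S l := by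
  rw [rate, linkRate_eq _ _ (hS l) (posDef_Omega N hS l), hSl, conj_streams]
  exact sum_log_sinr_le (posDef_Omega N hS l) hp _ r

lemma rate_nonneg {S : N.Cov} (hS : ∀ k, (S k).PosSemidef) (l : Fin L) : 0 ≤ N.rate S l := by
  obtain ⟨m, y, hy⟩ := posSemidef_iff_eq_sum_vecMulVec.mp (hS l)
  have hy' : S l = ∑ i, (((1 : ℝ)) : ℂ) • vecMulVec (y i) (star (y i)) := by simpa using hy
  -- Zero receivers have SINR `0 / 0 = 0`.
  refine le_trans (le_of_eq ?_) (N.sum_log_sinr_le_rate hS l (fun _ => zero_le_one) hy' 0)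
  simp

lemma Omega_smul (c : ℝ) (S : N.Cov) (l : Fin L) :
    N.Omega (fun k => (c : ℂ) • S k) l = 1 + (c : ℂ) • (N.Omega S l - 1) := by
  simp only [Omega, add_sub_cancel_left, Finset.smul_sum, Matrix.mul_smul, Matrix.smul_mul]
  congr 1
  exact Finset.sum_congr rfl fun k _ => smul_comm _ _ _

lemma qf_one_le_qf_Omega {S : N.Cov} (hS : ∀ k, (S k).PosSemidef) (l : Fin L)
    (v : Fin (N.nR l) → ℂ) : qf 1 v ≤ qf (N.Omega S l) v := by
  rw [Omega, qf_add, le_add_iff_nonneg_right]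
  exact qf_nonneg (posSemidef_sum _ fun k _ =>
    ((hS k).mul_mul_conjTranspose_same _).smul (by exact_mod_cast N.Φ_nonneg l k)) v

/-- Scaling up all covariances scales signal and interference but not the noise: no rate decreases,
and the positive ones increase. -/
lemma rate_smul {S : N.Cov} (hS : ∀ k, (S k).PosSemidef) {c : ℝ} (hc : 1 < c) (l : Fin L) :
    N.rate S l ≤ N.rate (fun k => (c : ℂ) • S k) l ∧
      (0 < N.rate S l → N.rate S l < N.rate (fun k => (c : ℂ) • S k) l) := by
  obtain ⟨m, y, hy⟩ := posSemidef_iff_eq_sum_vecMulVec.mp (hS l)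
  have hc0 : 0 ≤ c := by linarith
  have hy1 : S l = ∑ i, (((fun _ => 1 : Fin m → ℝ) i : ℝ) : ℂ) • vecMulVec (y i) (star (y i)) := by
    simpa using hy
  have hyc : (c : ℂ) • S l =
      ∑ i, (((fun _ => c : Fin m → ℝ) i : ℝ) : ℂ) • vecMulVec (y i) (star (y i)) := by
    rw [hy, Finset.smul_sum]
  have hSc : ∀ k, ((c : ℂ) • S k).PosSemidef := fun k => (hS k).smul (by exact_mod_cast hc0)
  set h : Fin m → Fin (N.nR l) → ℂ := fun i => N.H l l *ᵥ y i with hh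
  set V := sicNoise (N.Omega S l) (fun _ => 1) h with hVdef
  have hV : ∀ i, (V i).PosDef := posDef_sicNoise (posDef_Omega N hS l) (fun _ => zero_le_one) h
  -- The MMSE receivers of the unscaled family are kept for the scaled one.
  set r : Fin m → Fin (N.nR l) → ℂ := fun i => (1 : ℂ) • ((V i)⁻¹ *ᵥ h i) with hr
  have hrate : N.rate S l = ∑ i, Real.log (1 + 1 * ‖star (r i) ⬝ᵥ h i‖ ^ 2 / qf (V i) (r i)) := by
    rw [N.rate_eq_sum hS l (fun _ => zero_le_one) hy1]
    exact Finset.sum_congr rfl fun i _ => by rw [sinr_mmse (hV i) 1 (fun _ => one_ne_zero)]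
  have hle := N.sum_log_sinr_le_rate hSc l (fun _ => hc0) hyc r
  have hq : ∀ i, qf (sicNoise (N.Omega (fun k => (c : ℂ) • S k) l) (fun _ => c) h i) (r i) =
      qf 1 (r i) + c * (qf (V i) (r i) - qf 1 (r i)) := fun i => by
    rw [hVdef, sicNoise, sicNoise, Omega_smul]
    simp only [qf_add, qf_smul, qf_sub, qf_sum, ← Finset.mul_sum]
    ring
  have hqV : ∀ i, qf 1 (r i) ≤ qf (V i) (r i) := fun i => by
    rw [hVdef, sicNoise, qf_add]
    have h1 := N.qf_one_le_qf_Omega hS l (r i)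
    have h2 := qf_nonneg (posSemidef_sum (Finset.Ioi i) fun j _ =>
      posSemidef_smul_vecMulVec zero_le_one (h j)) (r i)
    linarith
  simp only [← hh, hq] at hle
  have term : ∀ i, 1 * ‖star (r i) ⬝ᵥ h i‖ ^ 2 / qf (V i) (r i) ≤ c * ‖star (r i) ⬝ᵥ h i‖ ^ 2 /
      (qf 1 (r i) + c * (qf (V i) (r i) - qf 1 (r i))) ∧ (‖star (r i) ⬝ᵥ h i‖ ^ 2 ≠ 0 →
      1 * ‖star (r i) ⬝ᵥ h i‖ ^ 2 / qf (V i) (r i) < c * ‖star (r i) ⬝ᵥ h i‖ ^ 2 /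
      (qf 1 (r i) + c * (qf (V i) (r i) - qf 1 (r i)))) := fun i => by
    rcases eq_or_ne (‖star (r i) ⬝ᵥ h i‖ ^ 2) 0 with h0 | h0
    · simp [h0]
    have hx : 0 < ‖star (r i) ⬝ᵥ h i‖ ^ 2 := lt_of_le_of_ne (by positivity) h0.symm
    have hr0 : r i ≠ 0 := by
      intro h; rw [h] at h0; simp at h0
    have hn : 0 < qf 1 (r i) := qf_pos PosDef.one hr0
    have hlt : 1 * ‖star (r i) ⬝ᵥ h i‖ ^ 2 / qf (V i) (r i) < c * ‖star (r i) ⬝ᵥ h i‖ ^ 2 /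
        (qf 1 (r i) + c * (qf (V i) (r i) - qf 1 (r i))) := by
      have := hqV i
      have hz : 0 ≤ c * (qf (V i) (r i) - qf 1 (r i)) := mul_nonneg hc0 (by linarith)
      rw [div_lt_div_iff₀ (by linarith) (by linarith)]
      have : qf 1 (r i) < c * qf 1 (r i) := by nlinarith
      nlinarith
    exact ⟨hlt.le, fun _ => hlt⟩
  have hpos : ∀ i, 0 ≤ 1 * ‖star (r i) ⬝ᵥ h i‖ ^ 2 / qf (V i) (r i) := fun i =>
    div_nonneg (by positivity) (qf_nonneg (hV i).posSemidef _)
  have hlog : ∀ i, Real.log (1 + 1 * ‖star (r i) ⬝ᵥ h i‖ ^ 2 / qf (V i) (r i)) ≤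
      Real.log (1 + c * ‖star (r i) ⬝ᵥ h i‖ ^ 2 /
        (qf 1 (r i) + c * (qf (V i) (r i) - qf 1 (r i)))) := fun i =>
    Real.log_le_log (by linarith [hpos i]) (by linarith [(term i).1])
  constructor
  · rw [hrate]
    exact (Finset.sum_le_sum fun i _ => hlog i).trans hle
  · intro h0
    rw [hrate] at h0 ⊢
    refine lt_of_lt_of_le (Finset.sum_lt_sum (fun i _ => hlog i) ?_) hle
    by_contra hcon
    push Not at hcon
    refine h0.ne' (Finset.sum_eq_zero fun i hi => ?_)
    by_contra hne
    have h2 : ‖star (r i) ⬝ᵥ h i‖ ^ 2 ≠ 0 := fun h => hne (by rw [h]; simp)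
    exact absurd (hcon i hi) (not_le.mpr
      (Real.log_lt_log (by linarith [hpos i]) (by linarith [(term i).2 h2])))

/-- A Pareto optimal family with a positive rate uses the least total power among the families
that achieve its rates: spare power could be spent by scaling up all covariances. -/
lemma IsParetoOptimal.power_le {N : BMAC L} {P : ℝ} {S : N.Cov} (hpar : N.IsParetoOptimal P S)
    (hrate : ∃ l, 0 < N.rate S l) {S' : N.Cov} (hS' : ∀ k, (S' k).PosSemidef)
    (hge : ∀ k, N.rate S k ≤ N.rate S' k) :
    ∑ k, (S k).trace.re ≤ ∑ k, (S' k).trace.re := by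
  by_contra! hlt
  obtain ⟨hS, hP, hmax⟩ := hpar
  set T := ∑ k, (S' k).trace.re with hT
  have hT0 : 0 ≤ T := Finset.sum_nonneg fun k _ => (Complex.le_def.mp (hS' k).trace_nonneg).1
  have hPT : 0 < P - T := by linarith
  -- A scaling factor above one that keeps the power within `P`, also when `T = 0`.
  set c := 1 + (P - T) / (T + 1) with hc
  have hc1 : 1 < c := by have : 0 < (P - T) / (T + 1) := by positivity
                         linarith
  have hcT : c * T ≤ P := by
    have : (P - T) / (T + 1) * T ≤ P - T := by
      rw [div_mul_eq_mul_div, div_le_iff₀ (by positivity)]; nlinarith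
    rw [hc]; linarith
  have hSc : ∀ k, ((c : ℂ) • S' k).PosSemidef := fun k =>
    (hS' k).smul (by exact_mod_cast (by linarith : (0 : ℝ) ≤ c))
  have hmem : N.rate (fun k => (c : ℂ) • S' k) ∈ N.rateRegion P := by
    refine ⟨fun l => N.rate_nonneg hSc l, _, hSc, ?_, fun l => le_rfl⟩
    simp only [trace_smul, smul_eq_mul, Complex.re_ofReal_mul, ← Finset.mul_sum]
    exact hcT
  have hle : N.rate S ≤ N.rate (fun k => (c : ℂ) • S' k) := fun k =>
    (hge k).trans (N.rate_smul hS' hc1 k).1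
  obtain ⟨l, hl⟩ := hrate
  have h1 := hmax.2 hmem hle l
  have h2 := (N.rate_smul hS' hc1 l).2 (hl.trans_le (hge l))
  exact absurd (h1.trans (hge l)) (not_le.mpr h2)

end Network

/-! ### Streams of a fixed family -/

section Streams

variable {L : ℕ} (N : BMAC L) {M : Fin L → ℕ} {p : ∀ l, Fin (M l) → ℝ}
  {t : ∀ l, Fin (M l) → Fin (N.nT l) → ℂ} {r : ∀ l, Fin (M l) → Fin (N.nR l) → ℂ}

lemma posSemidef_cov (hp : ∀ l m, 0 ≤ p l m) (l : Fin L) : (N.cov p t l).PosSemidef :=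
  posSemidef_sum _ fun _ _ => posSemidef_smul_vecMulVec (hp _ _) _

lemma trace_cov (ht : ∀ l m, ‖WithLp.toLp 2 (t l m)‖ = 1) (l : Fin L) :
    (N.cov p t l).trace.re = ∑ m, p l m := by
  rw [cov, trace_sum, Complex.re_sum]
  refine Finset.sum_congr rfl fun m _ => ?_
  have := trace_vecMulVec_mul_re (t l m) 1
  rw [Matrix.mul_one, qf_one, ht] at this
  rw [trace_smul, smul_eq_mul, Complex.re_ofReal_mul, this]
  ring

lemma gain_nonneg (l k : Fin L) (m : Fin (M l)) (n : Fin (M k)) : 0 ≤ N.gain t r l m k n :=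
  sq_nonneg _

lemma crossTalk_nonneg (s u : Σ l, Fin (M l)) : 0 ≤ N.crossTalk t r s u := by
  simp only [crossTalk, of_apply]
  split_ifs
  · exact le_rfl
  · exact N.gain_nonneg ..
  · exact mul_nonneg (N.Φ_nonneg _ _) (N.gain_nonneg ..)

/-- The noise-plus-interference power behind a receiver `v` when the streams `t` are sent with
powers `p` and transmitter `l` additionally uses the covariance `F`. -/
lemma qf_Omega_add_single (p : ∀ l, Fin (M l) → ℝ) (t : ∀ l, Fin (M l) → Fin (N.nT l) → ℂ)
    (l : Fin L) (F : Matrix (Fin (N.nT l)) (Fin (N.nT l)) ℂ) (k : Fin L)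
    (v : Fin (N.nR k) → ℂ) :
    qf (N.Omega (N.cov p t + Pi.single l F) k) v = qf 1 v +
      ∑ j, ∑ n, p j n * (N.Φ k j * ‖star v ⬝ᵥ (N.H k j *ᵥ t j n)‖ ^ 2) +
      N.Φ k l * qf F ((N.H k l)ᴴ *ᵥ v) := by
  have h1 : ∀ j n, ‖star v ⬝ᵥ (N.H k j *ᵥ t j n)‖ ^ 2 =
      qf (vecMulVec (t j n) (star (t j n))) ((N.H k j)ᴴ *ᵥ v) := fun j n => by
    rw [qf_vecMulVec, star_mulVec, conjTranspose_conjTranspose, ← dotProduct_mulVec]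
  have h2 : ∑ j, N.Φ k j * qf ((Pi.single l F : N.Cov) j) ((N.H k j)ᴴ *ᵥ v) =
      N.Φ k l * qf F ((N.H k l)ᴴ *ᵥ v) := by
    rw [Finset.sum_eq_single l]
    · rw [Pi.single_eq_same]
    · intro j _ hj
      rw [Pi.single_eq_of_ne hj, qf_zero_left, mul_zero]
    · simp
  rw [← h2, add_assoc, ← Finset.sum_add_distrib, Omega, qf_add, qf_sum]
  congr 1
  refine Finset.sum_congr rfl fun j _ => ?_
  rw [qf_smul, qf_conj', Pi.add_apply, qf_add, mul_add, cov, qf_sum, Finset.mul_sum]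
  congr 1
  refine Finset.sum_congr rfl fun n _ => ?_
  rw [qf_smul, h1]; ring

/-- For the receiver of a stream, the covariance left by successive cancellation yields the noise
power, the cross-talk and the interference from the additional covariance `F` at link `l`. -/
lemma qf_sicNoise_add_single (p : ∀ l, Fin (M l) → ℝ) (t : ∀ l, Fin (M l) → Fin (N.nT l) → ℂ)
    (r : ∀ l, Fin (M l) → Fin (N.nR l) → ℂ)
    (l : Fin L) (F : Matrix (Fin (N.nT l)) (Fin (N.nT l)) ℂ) (k : Fin L) (m : Fin (M k)) :
    qf (sicNoise (N.Omega (N.cov p t + Pi.single l F) k) (p k) (fun i => N.H k k *ᵥ t k i) m)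
        (r k m) =
      qf 1 (r k m) + ∑ j, ∑ n, p j n * N.crossTalk t r ⟨k, m⟩ ⟨j, n⟩ +
        N.Φ k l * qf F ((N.H k l)ᴴ *ᵥ r k m) := by
  have key : ∑ j, ∑ n, p j n * N.crossTalk t r ⟨k, m⟩ ⟨j, n⟩ =
      ∑ j, ∑ n, p j n * (N.Φ k j * ‖star (r k m) ⬝ᵥ (N.H k j *ᵥ t j n)‖ ^ 2) +
      ∑ i ∈ Finset.Ioi m, p k i * ‖star (r k m) ⬝ᵥ (N.H k k *ᵥ t k i)‖ ^ 2 := by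
    rw [← Finset.add_sum_erase _ _ (Finset.mem_univ k),
      ← Finset.add_sum_erase (Finset.univ) (fun j => ∑ n, p j n * (N.Φ k j * _))
        (Finset.mem_univ k)]
    have h1 : ∑ n, p k n * N.crossTalk t r ⟨k, m⟩ ⟨k, n⟩ =
        ∑ i ∈ Finset.Ioi m, p k i * ‖star (r k m) ⬝ᵥ (N.H k k *ᵥ t k i)‖ ^ 2 := by
      have : Finset.Ioi m = Finset.univ.filter fun i : Fin (M k) => ¬ (i : ℕ) ≤ (m : ℕ) := by
        ext i
        simp only [Finset.mem_Ioi, Finset.mem_filter, Finset.mem_univ, true_and,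
          not_le, Fin.lt_def]
      rw [this, Finset.sum_filter]
      refine Finset.sum_congr rfl fun n _ => ?_
      simp only [crossTalk, of_apply, if_true, gain]
      split_ifs <;> simp
    have h2 : ∑ j ∈ Finset.univ.erase k, ∑ n, p j n * N.crossTalk t r ⟨k, m⟩ ⟨j, n⟩ =
        ∑ j ∈ Finset.univ.erase k, ∑ n,
          p j n * (N.Φ k j * ‖star (r k m) ⬝ᵥ (N.H k j *ᵥ t j n)‖ ^ 2) := by
      refine Finset.sum_congr rfl fun j hj => Finset.sum_congr rfl fun n _ => ?_
      simp only [crossTalk, of_apply, if_neg (Finset.ne_of_mem_erase hj), gain]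
    rw [h1, h2, N.Φ_diag]
    simp only [zero_mul, mul_zero, Finset.sum_const_zero]
    ring
  rw [sicNoise, qf_add, qf_Omega_add_single, qf_sum, key]
  simp only [qf_smul, qf_vecMulVec]
  ring

lemma mmseFilter_eq (p : ∀ l, Fin (M l) → ℝ) (t : ∀ l, Fin (M l) → Fin (N.nT l) → ℂ)
    (l : Fin L) (m : Fin (M l)) :
    N.mmseFilter p t l m =
      (sicNoise (N.Omega (N.cov p t) l) (p l) (fun i => N.H l l *ᵥ t l i) m)⁻¹ *ᵥ
        (N.H l l *ᵥ t l m) := by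
  simp only [mmseFilter, sicNoise, conj_vecMulVec]
  rw [add_comm]

end Streams

/-! ### Families of least power -/

section PowerMinimal

variable {L : ℕ} {N : BMAC L} {M : Fin L → ℕ} {p : ∀ l, Fin (M l) → ℝ}
  {t : ∀ l, Fin (M l) → Fin (N.nT l) → ℂ} {r : ∀ l, Fin (M l) → Fin (N.nR l) → ℂ}

/-- Streams of positive power with unit beams and MMSE-SIC receivers, whose total power is least
among all families of covariances achieving the same rates. -/
structure IsPowerMinimal (N : BMAC L) (p : ∀ l, Fin (M l) → ℝ)
    (t : ∀ l, Fin (M l) → Fin (N.nT l) → ℂ) (r : ∀ l, Fin (M l) → Fin (N.nR l) → ℂ) : Prop where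
  pos : ∀ l m, 0 < p l m
  norm_t : ∀ l m, ‖WithLp.toLp 2 (t l m)‖ = 1
  mmse : N.IsMMSEReceiver p t r
  power_le : ∀ S : N.Cov, (∀ k, (S k).PosSemidef) → (∀ k, N.rate (N.cov p t) k ≤ N.rate S k) →
    ∑ k, ∑ m, p k m ≤ ∑ k, (S k).trace.re

lemma IsParetoOptimal.isPowerMinimal {P : ℝ} (hp : ∀ l m, 0 < p l m)
    (ht : ∀ l m, ‖WithLp.toLp 2 (t l m)‖ = 1) (hpar : N.IsParetoOptimal P (N.cov p t))
    (hrate : ∃ l, 0 < N.rate (N.cov p t) l) (hr : N.IsMMSEReceiver p t r) :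
    N.IsPowerMinimal p t r where
  pos := hp
  norm_t := ht
  mmse := hr
  power_le S hS hge := by
    have := hpar.power_le hrate hS hge
    simpa only [N.trace_cov ht] using this

/-- The covariance seen by stream `m` of link `l` in the family itself. -/
noncomputable def streamNoise (N : BMAC L) (p : ∀ l, Fin (M l) → ℝ)
    (t : ∀ l, Fin (M l) → Fin (N.nT l) → ℂ) (l : Fin L) (m : Fin (M l)) :
    Matrix (Fin (N.nR l)) (Fin (N.nR l)) ℂ :=
  sicNoise (N.Omega (N.cov p t) l) (p l) (fun i => N.H l l *ᵥ t l i) m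

lemma qf_streamNoise (N : BMAC L) (p : ∀ l, Fin (M l) → ℝ)
    (t : ∀ l, Fin (M l) → Fin (N.nT l) → ℂ) (r : ∀ l, Fin (M l) → Fin (N.nR l) → ℂ)
    (l : Fin L) (m : Fin (M l)) :
    qf (N.streamNoise p t l m) (r l m) =
      qf 1 (r l m) + ∑ j, ∑ n, p j n * N.crossTalk t r ⟨l, m⟩ ⟨j, n⟩ := by
  have := N.qf_sicNoise_add_single p t r l 0 l m
  rwa [Pi.single_zero, add_zero, qf_zero_left, mul_zero, add_zero] at this

/-- The power of the effective signal of a stream after whitening, `h† V⁻¹ h`. -/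
noncomputable def whitenedGain (N : BMAC L) (p : ∀ l, Fin (M l) → ℝ)
    (t : ∀ l, Fin (M l) → Fin (N.nT l) → ℂ) (l : Fin L) (m : Fin (M l)) : ℝ :=
  qf (N.streamNoise p t l m)⁻¹ (N.H l l *ᵥ t l m)

namespace IsPowerMinimal

variable (hN : N.IsPowerMinimal p t r)
include hN

lemma posSemidef (l : Fin L) : (N.cov p t l).PosSemidef :=
  N.posSemidef_cov (fun l m => (hN.pos l m).le) l

lemma posDef_streamNoise (l : Fin L) (m : Fin (M l)) : (N.streamNoise p t l m).PosDef :=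
  posDef_sicNoise (N.posDef_Omega hN.posSemidef l) (fun m => (hN.pos l m).le) _ m

lemma exists_mmse (l : Fin L) (m : Fin (M l)) : ∃ α : ℂ,
    r l m = α • ((N.streamNoise p t l m)⁻¹ *ᵥ (N.H l l *ᵥ t l m)) ∧
      (N.H l l *ᵥ t l m ≠ 0 → α ≠ 0 ∧ qf 1 (r l m) = 1) := by
  obtain ⟨α, h1, h2⟩ := hN.mmse l m
  rw [mmseFilter_eq] at h1 h2
  refine ⟨α, h1, fun hh => ?_⟩
  have hne : (N.streamNoise p t l m)⁻¹ *ᵥ (N.H l l *ᵥ t l m) ≠ 0 := fun h0 => by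
    have := qf_pos (hN.posDef_streamNoise l m).inv hh
    rw [qf, h0] at this
    simp at this
  have hn := h2 hne
  refine ⟨fun h0 => ?_, by rw [qf_one, hn]; norm_num⟩
  rw [h1, h0] at hn
  simp at hn

/-- The rate of a link is the sum of the rates of its streams behind the receivers `r`. -/
lemma rate_eq_sum_log (l : Fin L) : N.rate (N.cov p t) l =
    ∑ m, Real.log (1 + p l m * N.gain t r l m l m / qf (N.streamNoise p t l m) (r l m)) := by
  rw [N.rate_eq_sum hN.posSemidef l (fun m => (hN.pos l m).le) rfl]
  refine Finset.sum_congr rfl fun m _ => ?_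
  obtain ⟨α, h1, h2⟩ := hN.exists_mmse l m
  rw [gain, h1, sinr_mmse (hN.posDef_streamNoise l m) (p l m) fun hh => (h2 hh).1]
  rfl

/-- A link whose receivers see no more noise and interference than before keeps its rate, provided
that every stream with a positive gain keeps its power. -/
lemma rate_le_of_noise_le {S : N.Cov} (hS : ∀ k, (S k).PosSemidef) (k : Fin L)
    {p' : Fin (M k) → ℝ} (hp' : ∀ m, 0 ≤ p' m)
    (hSk : S k = ∑ m, (p' m : ℂ) • vecMulVec (t k m) (star (t k m)))
    (hpp : ∀ m, N.gain t r k m k m ≠ 0 → p k m = p' m)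
    (hle : ∀ m, qf (sicNoise (N.Omega S k) p' (fun i => N.H k k *ᵥ t k i) m) (r k m) ≤
      qf (N.streamNoise p t k m) (r k m)) : N.rate (N.cov p t) k ≤ N.rate S k := by
  rw [hN.rate_eq_sum_log]
  refine le_trans (Finset.sum_le_sum fun m _ => ?_) (N.sum_log_sinr_le_rate hS k hp' hSk (r k))
  have h0 : 0 ≤ p k m * N.gain t r k m k m / qf (N.streamNoise p t k m) (r k m) :=
    div_nonneg (mul_nonneg (hN.pos k m).le (N.gain_nonneg ..))
      (qf_nonneg (hN.posDef_streamNoise k m).posSemidef _)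
  refine Real.log_le_log (by linarith) (add_le_add le_rfl ?_)
  change _ ≤ p' m * N.gain t r k m k m / _
  rcases eq_or_ne (N.gain t r k m k m) 0 with hg | hg
  · simp [hg]
  rw [hpp m hg]
  have hr0 : r k m ≠ 0 := fun h => hg (by simp [gain, h])
  exact div_le_div_of_nonneg_left (mul_nonneg (hp' m) (N.gain_nonneg ..))
    (qf_pos (posDef_sicNoise (N.posDef_Omega hS k) hp' _ m) hr0) (hle m)

/-- In a family of least power no stream is lost in its own channel: it could be dropped. -/
lemma channel_ne_zero (l : Fin L) (m : Fin (M l)) : N.H l l *ᵥ t l m ≠ 0 := by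
  intro h0
  set p' : ∀ k, Fin (M k) → ℝ := fun k i =>
    if (⟨k, i⟩ : Σ k, Fin (M k)) = ⟨l, m⟩ then 0 else p k i with hp'
  have hp0 : ∀ k i, 0 ≤ p' k i := fun k i => by
    simp only [hp']; split_ifs
    · exact le_rfl
    · exact (hN.pos k i).le
  have hple : ∀ k i, p' k i ≤ p k i := fun k i => by
    simp only [hp']; split_ifs
    · exact (hN.pos k i).le
    · exact le_rfl
  have hS := N.posSemidef_cov (t := t) hp0
  have hle := hN.power_le _ hS fun k => hN.rate_le_of_noise_le hS k (hp0 k) rfl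
    (fun i hg => by
      simp only [hp']
      rw [if_neg]
      rintro h
      obtain ⟨rfl, h⟩ := Sigma.mk.inj_iff.mp h
      obtain rfl := eq_of_heq h
      exact hg (by simp [gain, h0]))
    (fun i => by
      have := N.qf_sicNoise_add_single p' t r k 0 k i
      rw [Pi.single_zero, add_zero, qf_zero_left, mul_zero, add_zero] at this
      rw [this, N.qf_streamNoise]
      gcongr with j _ n _
      · exact N.crossTalk_nonneg _ _
      · exact hple j n)
  simp only [N.trace_cov hN.norm_t] at hle
  refine absurd hle (not_le.mpr ?_)
  refine Finset.sum_lt_sum (fun k _ => Finset.sum_le_sum fun i _ => hple k i) ⟨l, Finset.mem_univ _,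
    Finset.sum_lt_sum (fun i _ => hple l i) ⟨m, Finset.mem_univ _, ?_⟩⟩
  simp [hp', hN.pos l m]

lemma qf_one_r (l : Fin L) (m : Fin (M l)) : qf 1 (r l m) = 1 := by
  obtain ⟨α, -, h2⟩ := hN.exists_mmse l m
  exact (h2 (hN.channel_ne_zero l m)).2

lemma whitenedGain_pos (l : Fin L) (m : Fin (M l)) : 0 < N.whitenedGain p t l m :=
  qf_pos (hN.posDef_streamNoise l m).inv (hN.channel_ne_zero l m)

/-- The interference-plus-noise power of each stream is the denominator of its SINR. -/
lemma qf_streamNoise_eq (l : Fin L) (m : Fin (M l)) : qf (N.streamNoise p t l m) (r l m) =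
    1 + ∑ j, ∑ n, p j n * N.crossTalk t r ⟨l, m⟩ ⟨j, n⟩ := by
  rw [N.qf_streamNoise, hN.qf_one_r]

lemma sinr_eq_div (l : Fin L) (m : Fin (M l)) : N.sinr p t r l m =
    p l m * N.gain t r l m l m / qf (N.streamNoise p t l m) (r l m) := by
  rw [sinr, hN.qf_streamNoise_eq]

lemma sinr_eq (l : Fin L) (m : Fin (M l)) : N.sinr p t r l m = p l m * N.whitenedGain p t l m := by
  obtain ⟨α, h1, h2⟩ := hN.exists_mmse l m
  rw [hN.sinr_eq_div, gain, h1, sinr_mmse (hN.posDef_streamNoise l m) (p l m) fun hh => (h2 hh).1,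
    whitenedGain]

lemma sinr_pos (l : Fin L) (m : Fin (M l)) : 0 < N.sinr p t r l m := by
  rw [hN.sinr_eq]; exact mul_pos (hN.pos l m) (hN.whitenedGain_pos l m)

lemma rate_eq_sum_log_sinr (l : Fin L) :
    N.rate (N.cov p t) l = ∑ m, Real.log (1 + N.sinr p t r l m) := by
  simp only [hN.rate_eq_sum_log, hN.sinr_eq_div]

lemma gain_pos (l : Fin L) (m : Fin (M l)) : 0 < N.gain t r l m l m := by
  refine lt_of_le_of_ne (N.gain_nonneg ..) fun h => ?_
  have := hN.sinr_pos l m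
  rw [sinr, ← h] at this
  simp at this

/-- The covariance of each link solves the power minimization problem of that link. -/
lemma trace_le_of_mem_feasible (l : Fin L) {X : Matrix (Fin (N.nT l)) (Fin (N.nT l)) ℂ}
    (hX : X ∈ N.feasible (N.cov p t) r l) : (N.cov p t l).trace.re ≤ X.trace.re := by
  obtain ⟨hX0, hXr, hXi⟩ := hX
  set S : N.Cov := N.cov p t + Pi.single l (X - N.cov p t l) with hSdef
  have hSl : S l = X := by simp [hSdef]
  have hSk : ∀ k, k ≠ l → S k = N.cov p t k := fun k hk => by
    simp [hSdef, Pi.single_eq_of_ne hk]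
  have hS : ∀ k, (S k).PosSemidef := fun k => by
    rcases eq_or_ne k l with rfl | hk
    · rw [hSl]; exact hX0
    · rw [hSk k hk]; exact hN.posSemidef k
  have hOl : N.Omega S l = N.Omega (N.cov p t) l := by
    simp only [Omega]
    congr 1
    refine Finset.sum_congr rfl fun k _ => ?_
    rcases eq_or_ne k l with rfl | hk
    · simp [N.Φ_diag]
    · rw [hSk k hk]
  have hpow := hN.power_le S hS fun k => by
    rcases eq_or_ne k l with rfl | hk
    · exact hXr.trans_eq (by rw [rate, hOl, hSl])
    · refine hN.rate_le_of_noise_le hS k (fun m => (hN.pos k m).le) (hSk k hk) (fun _ _ => rfl)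
        fun m => ?_
      rw [hSdef, N.qf_sicNoise_add_single, N.qf_streamNoise, add_le_iff_nonpos_right]
      have h1 : ∀ Y : Matrix (Fin (N.nT l)) (Fin (N.nT l)) ℂ,
          (Y * N.interfMatrix r l k m).trace.re = N.Φ k l * qf Y ((N.H k l)ᴴ *ᵥ r k m) := by
        intro Y
        have := conj_vecMulVec (N.H k l)ᴴ (r k m)
        rw [conjTranspose_conjTranspose] at this
        rw [interfMatrix, this, Matrix.mul_smul, trace_smul, smul_eq_mul, Complex.re_ofReal_mul,
          trace_mul_comm, trace_vecMulVec_mul_re]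
      have h2 := hXi ⟨k, hk⟩ m
      rw [h1, h1] at h2
      rw [qf_sub, mul_sub]
      linarith
  have hsum : ∑ k, (S k).trace.re - ∑ k, ∑ m, p k m = X.trace.re - (N.cov p t l).trace.re := by
    simp only [← N.trace_cov hN.norm_t]
    rw [← Finset.sum_sub_distrib, Finset.sum_eq_single l]
    · rw [hSl]
    · intro k _ hk
      rw [hSk k hk, sub_self]
    · simp
  linarith

end IsPowerMinimal

end PowerMinimal

/-! ### Reverse powers as prices -/

section Prices

variable {L : ℕ} {N : BMAC L} {M : Fin L → ℕ} {p : ∀ l, Fin (M l) → ℝ}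
  {t : ∀ l, Fin (M l) → Fin (N.nT l) → ℂ} {r : ∀ l, Fin (M l) → Fin (N.nR l) → ℂ}

/-- The rate of a link to whose streams a further one with beam `x` and power `ε` is added. The new
stream is decoded first, so that the others do not notice it. -/
lemma sum_log_sinr_add_stream_le_rate {S : N.Cov} (hS : ∀ k, (S k).PosSemidef) (l : Fin L)
    {m : ℕ} {p' : Fin m → ℝ} (hp : ∀ i, 0 ≤ p' i) {y : Fin m → Fin (N.nT l) → ℂ} {ε : ℝ}
    (hε : 0 ≤ ε) {x : Fin (N.nT l) → ℂ}
    (hSl : S l = ∑ i, (p' i : ℂ) • vecMulVec (y i) (star (y i)) + (ε : ℂ) • vecMulVec x (star x))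
    (r₀ : Fin (N.nR l) → ℂ) (r : Fin m → Fin (N.nR l) → ℂ) :
    Real.log (1 + ε * ‖star r₀ ⬝ᵥ (N.H l l *ᵥ x)‖ ^ 2 / qf (N.Omega S l +
        ∑ i, (p' i : ℂ) • vecMulVec (N.H l l *ᵥ y i) (star (N.H l l *ᵥ y i))) r₀) +
      ∑ i, Real.log (1 + p' i * ‖star (r i) ⬝ᵥ (N.H l l *ᵥ y i)‖ ^ 2 /
        qf (sicNoise (N.Omega S l) p' (fun i => N.H l l *ᵥ y i) i) (r i)) ≤ N.rate S l := by
  have hW := N.posDef_Omega hS l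
  have hV := posDef_add_streams hW hp fun i => N.H l l *ᵥ y i
  have h1 := sinr_le_mmse hV hε r₀ (N.H l l *ᵥ x)
  have h2 := sum_log_sinr_le hW hp (fun i => N.H l l *ᵥ y i) r
  have h3 := div_nonneg (mul_nonneg hε (sq_nonneg ‖star r₀ ⬝ᵥ (N.H l l *ᵥ x)‖))
    (qf_nonneg hV.posSemidef r₀)
  have h4 := Real.log_le_log (by linarith) (add_le_add_right h1 1)
  have h5 : N.H l l * S l * (N.H l l)ᴴ =
      ∑ i, (p' i : ℂ) • vecMulVec (N.H l l *ᵥ y i) (star (N.H l l *ᵥ y i)) +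
        (ε : ℂ) • vecMulVec (N.H l l *ᵥ x) (star (N.H l l *ᵥ x)) := by
    rw [hSl, Matrix.mul_add, Matrix.add_mul, conj_streams, Matrix.mul_smul, Matrix.smul_mul,
      conj_vecMulVec]
  rw [rate, linkRate_eq _ _ (hS l) hW, h5, ← add_assoc, logDet_rank_one_update hV hε]
  linarith

/-- The rate of an additional stream of SINR `ε σ` makes up for the loss of another stream that
suffers the additional interference `ε b`. -/
lemma log_one_add_le_of_tradeoff {γ u b ε σ : ℝ} (hγ : 0 < γ) (hu : 0 < u) (hb : 0 ≤ b)
    (hε : 0 < ε) (hσ : 0 ≤ σ) (h : γ ^ 2 * b ≤ u * (1 + γ) * σ) :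
    Real.log (1 + γ) ≤ Real.log (1 + ε * σ) + Real.log (1 + u / (u / γ + ε * b)) := by
  have hd : 0 < u / γ + ε * b := by positivity
  rw [← Real.log_mul (by positivity) (by positivity)]
  refine Real.log_le_log (by positivity) ?_
  have e : 1 + u / (u / γ + ε * b) = (u * (1 + γ) + γ * ε * b) / (u + γ * ε * b) := by
    have : u + γ * ε * b ≠ 0 := by positivity
    field_simp
    ring
  rw [e, mul_div_assoc', le_div_iff₀ (by positivity)]
  have h1 : 0 ≤ ε * (u * (1 + γ) * σ - γ ^ 2 * b) := mul_nonneg hε.le (by linarith)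
  have h2 : 0 ≤ ε * σ * (γ * ε * b) := by positivity
  nlinarith

/-- The coefficient `g / γ` of the power of a stream in the equation that fixes its SINR. -/
noncomputable def sinrCoeff (N : BMAC L) (p : ∀ l, Fin (M l) → ℝ)
    (t : ∀ l, Fin (M l) → Fin (N.nT l) → ℂ) (r : ∀ l, Fin (M l) → Fin (N.nR l) → ℂ)
    (s : Σ l, Fin (M l)) : ℝ :=
  N.gain t r s.1 s.2 s.1 s.2 / N.sinr p t r s.1 s.2

namespace IsPowerMinimal

variable (hN : N.IsPowerMinimal p t r)
include hN

lemma sinrDiag_inv : (N.sinrDiag t r (N.sinr p t r))⁻¹ = diagonal (N.sinrCoeff p t r) := by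
  refine inv_eq_right_inv ?_
  rw [sinrDiag, diagonal_mul_diagonal, ← diagonal_one]
  congr 1
  funext s
  have h1 := (hN.gain_pos s.1 s.2).ne'
  have h2 := (hN.sinr_pos s.1 s.2).ne'
  rw [sinrCoeff]
  field_simp

lemma sinrCoeff_mul_power (s : Σ l, Fin (M l)) : N.sinrCoeff p t r s * p s.1 s.2 =
    1 + ∑ j, ∑ n, p j n * N.crossTalk t r s ⟨j, n⟩ := by
  have h0 := qf_pos (hN.posDef_streamNoise s.1 s.2) (v := r s.1 s.2) (fun h => by
    have := hN.qf_one_r s.1 s.2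
    rw [h, qf_zero_right] at this
    norm_num at this)
  rw [hN.qf_streamNoise_eq] at h0
  have h1 := (hN.gain_pos s.1 s.2).ne'
  have h2 := (hN.pos s.1 s.2).ne'
  rw [sinrCoeff, sinr]
  field_simp

/-- The SINR equations: the powers are mapped to the noise powers by `D⁻¹ - Ψ`. -/
lemma mulVec_power_eq_one :
    (diagonal (N.sinrCoeff p t r) - N.crossTalk t r) *ᵥ (fun s => p s.1 s.2) = fun _ => 1 := by
  funext s
  have := hN.sinrCoeff_mul_power s
  rw [sub_mulVec, Pi.sub_apply, mulVec_diagonal, mulVec, dotProduct, Fintype.sum_sigma, this]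
  simp only [mul_comm]
  ring

lemma revPower_nonneg (l : Fin L) (m : Fin (M l)) : 0 ≤ N.revPower p t r l m := by
  rw [revPower, hN.sinrDiag_inv]
  exact (dualPower_spec N.crossTalk_nonneg (fun s => hN.pos s.1 s.2) hN.mulVec_power_eq_one).2 _

lemma mulVec_revPower_eq_one :
    (diagonal (N.sinrCoeff p t r) - (N.crossTalk t r)ᵀ) *ᵥ
      (fun s => N.revPower p t r s.1 s.2) = fun _ => 1 := by
  have := (dualPower_spec N.crossTalk_nonneg (fun s => hN.pos s.1 s.2) hN.mulVec_power_eq_one).1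
  rw [← hN.sinrDiag_inv] at this ⊢
  exact this

/-- The SINR equations of the reverse links. -/
lemma sinrCoeff_mul_revPower (s : Σ l, Fin (M l)) :
    N.sinrCoeff p t r s * N.revPower p t r s.1 s.2 =
      1 + ∑ j, ∑ n, N.revPower p t r j n * N.crossTalk t r ⟨j, n⟩ s := by
  have := congrFun hN.mulVec_revPower_eq_one s
  rw [sub_mulVec, Pi.sub_apply, mulVec_diagonal, mulVec, dotProduct, Fintype.sum_sigma] at this
  simp only [transpose_apply] at this
  simp only [mul_comm (N.revPower p t r _ _) (N.crossTalk t r _ _)]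
  linarith

end IsPowerMinimal

/-- The price of a unit of rate at stream `m` of link `l`. -/
noncomputable def ratePrice (N : BMAC L) (p : ∀ l, Fin (M l) → ℝ)
    (t : ∀ l, Fin (M l) → Fin (N.nT l) → ℂ) (r : ∀ l, Fin (M l) → Fin (N.nR l) → ℂ)
    (l : Fin L) (m : Fin (M l)) : ℝ :=
  N.revPower p t r l m * p l m * (1 + N.sinr p t r l m) * N.gain t r l m l m / N.sinr p t r l m ^ 2

/-- The covariance of everything that link `l` receives. -/
noncomputable def received (N : BMAC L) (p : ∀ l, Fin (M l) → ℝ)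
    (t : ∀ l, Fin (M l) → Fin (N.nT l) → ℂ) (l : Fin L) :
    Matrix (Fin (N.nR l)) (Fin (N.nR l)) ℂ :=
  N.Omega (N.cov p t) l +
    ∑ i, (p l i : ℂ) • vecMulVec (N.H l l *ᵥ t l i) (star (N.H l l *ᵥ t l i))

/-- The power of everything that link `l` receives behind the receiver `v`. -/
noncomputable def receivedPower (N : BMAC L) (p : ∀ l, Fin (M l) → ℝ)
    (t : ∀ l, Fin (M l) → Fin (N.nT l) → ℂ) (l : Fin L) (v : Fin (N.nR l) → ℂ) : ℝ :=
  qf 1 v + ∑ j, ∑ n, p j n * (N.Φ l j * ‖star v ⬝ᵥ (N.H l j *ᵥ t j n)‖ ^ 2) +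
    ∑ i, p l i * ‖star v ⬝ᵥ (N.H l l *ᵥ t l i)‖ ^ 2

lemma qf_add_single_add_streams (N : BMAC L) (p : ∀ l, Fin (M l) → ℝ)
    (t : ∀ l, Fin (M l) → Fin (N.nT l) → ℂ) (l : Fin L)
    (F : Matrix (Fin (N.nT l)) (Fin (N.nT l)) ℂ) (v : Fin (N.nR l) → ℂ) :
    qf (N.Omega (N.cov p t + Pi.single l F) l +
      ∑ i, (p l i : ℂ) • vecMulVec (N.H l l *ᵥ t l i) (star (N.H l l *ᵥ t l i))) v =
      N.receivedPower p t l v := by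
  simp only [receivedPower, qf_add, N.qf_Omega_add_single, qf_sum, qf_smul, qf_vecMulVec, N.Φ_diag,
    zero_mul, add_zero]

namespace IsPowerMinimal

variable (hN : N.IsPowerMinimal p t r)
include hN

lemma posDef_received (l : Fin L) : (N.received p t l).PosDef :=
  posDef_add_streams (N.posDef_Omega hN.posSemidef l) (fun m => (hN.pos l m).le) _

/-- The exchange that bounds the price of rate: a new beam `x` of power `ε` at link `l` takes over
rate from stream `m`, which is allowed the additional interference `ε b`, while the other powers
keep all other SINRs. Such an exchange saves no power. -/
lemma power_le_of_exchange (l : Fin L) (m : Fin (M l)) (x : Fin (N.nT l) → ℂ)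
    {p' : ∀ k, Fin (M k) → ℝ} (hpos : ∀ k n, 0 < p' k n) {ε b : ℝ} (hε : 0 < ε) (hb : 0 ≤ b)
    (hsinr : ∀ s : Σ k, Fin (M k),
      1 + ∑ j, ∑ n, p' j n * N.crossTalk t r s ⟨j, n⟩ +
        ε * (N.Φ s.1 l * ‖star (r s.1 s.2) ⬝ᵥ (N.H s.1 l *ᵥ x)‖ ^ 2) =
      N.sinrCoeff p t r s * p' s.1 s.2 +
        ε * (b * (Pi.single ⟨l, m⟩ 1 : (Σ k, Fin (M k)) → ℝ) s))
    {r₀ : Fin (N.nR l) → ℂ} (hr₀ : r₀ ≠ 0)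
    (hrate : N.sinr p t r l m ^ 2 * b * N.receivedPower p' t l r₀ ≤
      p' l m * N.gain t r l m l m * (1 + N.sinr p t r l m) *
        ‖star r₀ ⬝ᵥ (N.H l l *ᵥ x)‖ ^ 2) :
    ∑ k, ∑ n, p k n ≤ ∑ k, ∑ n, p' k n + ε * qf 1 x := by
  set e : (Σ k, Fin (M k)) → ℝ := Pi.single ⟨l, m⟩ 1 with he
  set S : N.Cov := N.cov p' t + Pi.single l ((ε : ℂ) • vecMulVec x (star x)) with hS_def
  have hS : ∀ k, (S k).PosSemidef := fun k => by
    refine (N.posSemidef_cov (fun k n => (hpos k n).le) k).add ?_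
    rcases eq_or_ne k l with rfl | hk
    · rw [Pi.single_eq_same]; exact posSemidef_smul_vecMulVec hε.le x
    · rw [Pi.single_eq_of_ne hk]; exact PosSemidef.zero
  have hden : ∀ k n, qf (sicNoise (N.Omega S k) (p' k) (fun i => N.H k k *ᵥ t k i) n)
      (r k n) = p' k n * N.gain t r k n k n / N.sinr p t r k n + ε * (b * e ⟨k, n⟩) := by
    intro k n
    rw [hS_def, N.qf_sicNoise_add_single, hN.qf_one_r, qf_smul, qf_vecMulVec, star_mulVec,
      conjTranspose_conjTranspose, ← dotProduct_mulVec]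
    have h1 := hsinr ⟨k, n⟩
    simp only [sinrCoeff] at h1
    linear_combination h1
  have hterm : ∀ k n, e ⟨k, n⟩ = 0 → p' k n * ‖star (r k n) ⬝ᵥ (N.H k k *ᵥ t k n)‖ ^ 2 /
      qf (sicNoise (N.Omega S k) (p' k) (fun i => N.H k k *ᵥ t k i) n) (r k n) =
      N.sinr p t r k n := by
    intro k n hk
    rw [hden, hk]
    change p' k n * N.gain t r k n k n / _ = _
    have h1 := (hpos k n).ne'
    have h2 := (hN.gain_pos k n).ne'
    have h3 := (hN.sinr_pos k n).ne'
    simp only [mul_zero, add_zero]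
    field_simp
  have hge : ∀ k, N.rate (N.cov p t) k ≤ N.rate S k := by
    intro k
    rw [hN.rate_eq_sum_log_sinr]
    rcases eq_or_ne k l with rfl | hk
    · refine le_trans ?_ (sum_log_sinr_add_stream_le_rate hS k (fun n => (hpos k n).le) hε.le
        (y := t k) (x := x) (by simp [hS_def, cov]) r₀ (r k))
      rw [hS_def, N.qf_add_single_add_streams]
      have hQpos : 0 < N.receivedPower p' t k r₀ := by
        rw [← N.qf_add_single_add_streams p' t k ((ε : ℂ) • vecMulVec x (star x))]
        exact qf_pos (posDef_add_streams (N.posDef_Omega hS k) (fun n => (hpos k n).le) _) hr₀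
      have hm : Real.log (1 + N.sinr p t r k m) ≤
          Real.log (1 + ε * ‖star r₀ ⬝ᵥ (N.H k k *ᵥ x)‖ ^ 2 / N.receivedPower p' t k r₀) +
          Real.log (1 + p' k m * ‖star (r k m) ⬝ᵥ (N.H k k *ᵥ t k m)‖ ^ 2 /
            qf (sicNoise (N.Omega S k) (p' k) (fun i => N.H k k *ᵥ t k i) m) (r k m)) := by
        have he1 : e ⟨k, m⟩ = 1 := Pi.single_eq_same _ 1
        rw [hden, he1, mul_one, mul_div_assoc]
        refine log_one_add_le_of_tradeoff (hN.sinr_pos k m)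
          (mul_pos (hpos k m) (hN.gain_pos k m)) hb hε (by positivity) ?_
        rw [mul_div_assoc', le_div_iff₀ hQpos]
        exact hrate
      have hrest : ∑ n ∈ Finset.univ.erase m, Real.log (1 + N.sinr p t r k n) =
          ∑ n ∈ Finset.univ.erase m,
            Real.log (1 + p' k n * ‖star (r k n) ⬝ᵥ (N.H k k *ᵥ t k n)‖ ^ 2 /
              qf (sicNoise (N.Omega S k) (p' k) (fun i => N.H k k *ᵥ t k i) n) (r k n)) := by
        refine Finset.sum_congr rfl fun n hn => ?_
        have hne : (⟨k, n⟩ : Σ k, Fin (M k)) ≠ ⟨k, m⟩ := fun h =>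
          Finset.ne_of_mem_erase hn (eq_of_heq (Sigma.mk.inj_iff.mp h).2)
        rw [hterm k n (Pi.single_eq_of_ne hne 1)]
      rw [← Finset.add_sum_erase _ _ (Finset.mem_univ m), hrest]
      refine (add_le_add_left hm _).trans_eq ?_
      rw [add_assoc]
      congr 1
      exact Finset.add_sum_erase Finset.univ (fun n =>
        Real.log (1 + p' k n * ‖star (r k n) ⬝ᵥ (N.H k k *ᵥ t k n)‖ ^ 2 /
          qf (sicNoise (N.Omega S k) (p' k) (fun i => N.H k k *ᵥ t k i) n) (r k n)))
        (Finset.mem_univ m)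
    · refine le_trans (le_of_eq ?_) (N.sum_log_sinr_le_rate hS k (fun n => (hpos k n).le)
        (y := t k) (by simp [hS_def, cov, Pi.single_eq_of_ne hk]) (r k))
      refine Finset.sum_congr rfl fun n _ => ?_
      rw [hterm k n (Pi.single_eq_of_ne (fun h => hk (Sigma.mk.inj_iff.mp h).1) 1)]
  refine (hN.power_le S hS hge).trans_eq ?_
  have h1 : ∀ k, (S k).trace.re =
      ∑ n, p' k n + ((Pi.single l ((ε : ℂ) • vecMulVec x (star x)) : N.Cov) k).trace.re := by
    intro k
    rw [← N.trace_cov hN.norm_t, ← Complex.add_re, ← trace_add]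
    rfl
  have h2 : ∑ k, ((Pi.single l ((ε : ℂ) • vecMulVec x (star x)) : N.Cov) k).trace.re =
      ε * qf 1 x := by
    rw [Finset.sum_eq_single l (fun k _ hk => by rw [Pi.single_eq_of_ne hk]; simp) (by simp),
      Pi.single_eq_same, trace_smul, smul_eq_mul, Complex.re_ofReal_mul,
      ← trace_vecMulVec_mul_re, Matrix.mul_one]
  simp only [h1, Finset.sum_add_distrib, h2]

/-- No further beam `x` of link `l` is profitable: its own power and the price of the interference
that it causes are at least the price of the rate that it brings. -/
lemma ratePrice_mul_le (l : Fin L) (m : Fin (M l)) (x : Fin (N.nT l) → ℂ) :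
    N.ratePrice p t r l m * qf (N.received p t l)⁻¹ (N.H l l *ᵥ x) ≤
      qf 1 x + ∑ k, ∑ n, N.revPower p t r k n *
        (N.Φ k l * ‖star (r k n) ⬝ᵥ (N.H k l *ᵥ x)‖ ^ 2) := by
  by_contra! hlt
  set q : (Σ l, Fin (M l)) → ℝ := fun s => N.revPower p t r s.1 s.2 with hq
  set c : (Σ l, Fin (M l)) → ℝ :=
    fun s => N.Φ s.1 l * ‖star (r s.1 s.2) ⬝ᵥ (N.H s.1 l *ᵥ x)‖ ^ 2 with hc
  set s₀ : Σ l, Fin (M l) := ⟨l, m⟩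
  set γ := N.sinr p t r l m with hγ_def
  set g := N.gain t r l m l m with hg_def
  set y := N.H l l *ᵥ x with hy
  set a := qf (N.received p t l)⁻¹ y with ha
  have hγ : 0 < γ := hN.sinr_pos l m
  have hg : 0 < g := hN.gain_pos l m
  have ha0 : 0 ≤ a := qf_nonneg (hN.posDef_received l).inv.posSemidef y
  have hq0 : ∀ s, 0 ≤ q s := fun s => hN.revPower_nonneg s.1 s.2
  have hp0 := hN.pos l m
  have hcost0 : 0 ≤ qf 1 x + ∑ s, q s * c s :=
    add_nonneg (qf_nonneg PosSemidef.one x) (Finset.sum_nonneg fun s _ =>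
      mul_nonneg (hq0 s) (mul_nonneg (N.Φ_nonneg _ _) (sq_nonneg _)))
  set b₀ := p l m * g * (1 + γ) * a / γ ^ 2 with hb₀
  have hlt' : qf 1 x + ∑ s, q s * c s < q s₀ * b₀ := by
    rw [Fintype.sum_sigma]
    refine hlt.trans_eq ?_
    rw [ratePrice, hb₀]
    ring
  have hb₀0 : 0 ≤ b₀ := by positivity
  have hqb : 0 < q s₀ * b₀ := hcost0.trans_lt hlt'
  have hqs : 0 < q s₀ := pos_of_mul_pos_left hqb hb₀0
  have hb₀1 : 0 < b₀ := pos_of_mul_pos_right hqb hqs.le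
  have ha1 : 0 < a := lt_of_le_of_ne ha0 fun h => by
    rw [hb₀, ← h] at hb₀1; simp at hb₀1
  -- The loss `b` granted to stream `m` per unit of power of the new beam: less than what the new
  -- beam makes up for, yet enough to make the exchange profitable.
  obtain ⟨b, hb1, hb2⟩ := exists_between ((div_lt_iff₀' hqs).mpr hlt')
  have hb : 0 ≤ b := (div_nonneg hcost0 hqs.le).trans hb1.le
  rw [div_lt_iff₀' hqs] at hb1
  -- The direction `d` in which the other powers move to keep all SINR equations but one.
  set B := diagonal (N.sinrCoeff p t r) - N.crossTalk t r with hB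
  set e : (Σ l, Fin (M l)) → ℝ := Pi.single s₀ 1 with he
  set d : (Σ l, Fin (M l)) → ℝ := B⁻¹ *ᵥ (c - b • e) with hd
  have hBu : IsUnit B.det := isUnit_det_of_mulVec_eq_one N.crossTalk_nonneg
    (fun s => hN.pos s.1 s.2) hN.mulVec_power_eq_one
  have hBd : B *ᵥ d = c - b • e := by
    rw [hd, mulVec_mulVec, mul_nonsing_inv _ hBu, one_mulVec]
  have hsumd : ∑ s, d s = ∑ s, q s * c s - q s₀ * b := by
    have h1 : q ᵥ* B = fun _ => 1 := by
      rw [← mulVec_transpose, hB, transpose_sub, diagonal_transpose]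
      exact hN.mulVec_revPower_eq_one
    calc ∑ s, d s = (q ᵥ* B) ⬝ᵥ d := by rw [h1]; simp [dotProduct]
      _ = q ⬝ᵥ (c - b • e) := by rw [← dotProduct_mulVec, hBd]
      _ = _ := by
        rw [dotProduct_sub, dotProduct_smul, he, dotProduct_single, smul_eq_mul]
        simp only [dotProduct]; ring
  set pw : ℝ → ∀ k, Fin (M k) → ℝ := fun ε k n => p k n + ε * d ⟨k, n⟩ with hpw
  set r₀ := (1 : ℂ) • ((N.received p t l)⁻¹ *ᵥ y) with hr₀
  have hpw0 : pw 0 = p := by funext k n; simp [hpw]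
  have hQcont : Continuous fun ε => N.receivedPower (pw ε) t l r₀ := by
    simp only [receivedPower, hpw]
    fun_prop
  have hQ0 : N.receivedPower p t l r₀ = a := by
    have h1 := N.qf_add_single_add_streams p t l 0 r₀
    rw [Pi.single_zero, add_zero] at h1
    rw [← h1]
    change qf (N.received p t l) r₀ = a
    rw [hr₀, qf_mmse (hN.posDef_received l)]
    simp [ha]
  have hr₀y : ‖star r₀ ⬝ᵥ y‖ ^ 2 = a ^ 2 := by
    rw [hr₀, norm_star_mmse_dotProduct_self (hN.posDef_received l)]
    simp [ha]
  have hr₀0 : r₀ ≠ 0 := fun h => by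
    rw [h, star_zero, zero_dotProduct, norm_zero] at hr₀y
    nlinarith
  have hev1 : ∀ᶠ ε in nhds (0 : ℝ), ∀ s : Σ l, Fin (M l), 0 < pw ε s.1 s.2 := by
    rw [Filter.eventually_all]
    intro s
    have hcont : Continuous fun ε => pw ε s.1 s.2 := by simp only [hpw]; fun_prop
    refine hcont.continuousAt.eventually_const_lt ?_
    simp only [hpw0]; exact hN.pos s.1 s.2
  have hev2 : ∀ᶠ ε in nhds (0 : ℝ),
      γ ^ 2 * b * N.receivedPower (pw ε) t l r₀ < pw ε l m * g * (1 + γ) * a ^ 2 := by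
    have hc1 : Continuous fun ε => γ ^ 2 * b * N.receivedPower (pw ε) t l r₀ := by fun_prop
    have hc2 : Continuous fun ε => pw ε l m * g * (1 + γ) * a ^ 2 := by
      simp only [hpw]; fun_prop
    refine hc1.continuousAt.eventually_lt hc2.continuousAt ?_
    rw [hpw0, hQ0]
    rw [hb₀, lt_div_iff₀ (by positivity)] at hb2
    nlinarith
  obtain ⟨ε, ⟨hpos, hrate⟩, hε⟩ := (((hev1.and hev2).filter_mono nhdsWithin_le_nhds).and
    (self_mem_nhdsWithin (s := Set.Ioi (0 : ℝ)))).exists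
  replace hε : 0 < ε := hε
  have hpow := hN.power_le_of_exchange l m x (fun k n => hpos ⟨k, n⟩) hε hb (fun s => by
      have h1 := congrFun hN.mulVec_power_eq_one s
      have h2 := congrFun hBd s
      rw [sub_mulVec, Pi.sub_apply, mulVec_diagonal, mulVec, dotProduct, Fintype.sum_sigma] at h1
      rw [hB, sub_mulVec, Pi.sub_apply, mulVec_diagonal, mulVec, dotProduct,
        Fintype.sum_sigma] at h2
      simp only [Pi.sub_apply, Pi.smul_apply, smul_eq_mul, hc] at h1 h2
      have h3 : ∑ j, ∑ i, pw ε j i * N.crossTalk t r s ⟨j, i⟩ =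
          ∑ j, ∑ i, N.crossTalk t r s ⟨j, i⟩ * p j i +
            ε * ∑ j, ∑ i, N.crossTalk t r s ⟨j, i⟩ * d ⟨j, i⟩ := by
        simp only [Finset.mul_sum, ← Finset.sum_add_distrib, hpw]
        refine Finset.sum_congr rfl fun j _ => Finset.sum_congr rfl fun i _ => ?_
        ring
      rw [h3]
      simp only [hpw]
      linear_combination -h1 - ε * h2) hr₀0 (hr₀y ▸ hrate.le)
  have hsum : ∑ k, ∑ n, pw ε k n = ∑ k, ∑ n, p k n + ε * ∑ s, d s := by
    rw [Fintype.sum_sigma]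
    simp only [hpw, Finset.sum_add_distrib, Finset.mul_sum]
  rw [hsum, hsumd] at hpow
  nlinarith

end IsPowerMinimal

end Prices

/-! ### Stationarity and duality -/

section Duality

variable {L : ℕ} {N : BMAC L} {M : Fin L → ℕ} {p : ∀ l, Fin (M l) → ℝ}
  {t : ∀ l, Fin (M l) → Fin (N.nT l) → ℂ} {r : ∀ l, Fin (M l) → Fin (N.nR l) → ℂ}

lemma qf_revOmega (N : BMAC L) (q : ∀ l, Fin (M l) → ℝ) (r : ∀ l, Fin (M l) → Fin (N.nR l) → ℂ)
    (l : Fin L) (x : Fin (N.nT l) → ℂ) : qf (N.revOmega (N.revCov q r) l) x =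
      qf 1 x + ∑ k, ∑ n, q k n * (N.Φ k l * ‖star (r k n) ⬝ᵥ (N.H k l *ᵥ x)‖ ^ 2) := by
  have h1 : ∀ k n, ‖star (N.H k l *ᵥ x) ⬝ᵥ r k n‖ ^ 2 = ‖star (r k n) ⬝ᵥ (N.H k l *ᵥ x)‖ ^ 2 := by
    intro k n
    rw [star_dotProduct, norm_star]
  rw [revOmega, qf_add, qf_sum]
  congr 1
  refine Finset.sum_congr rfl fun k _ => ?_
  rw [qf_smul, qf_conj, revCov, qf_sum, Finset.mul_sum]
  refine Finset.sum_congr rfl fun n _ => ?_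
  rw [qf_smul, qf_vecMulVec, h1]; ring

lemma A_eq_revOmega (N : BMAC L) (q : ∀ l, Fin (M l) → ℝ)
    (r : ∀ l, Fin (M l) → Fin (N.nR l) → ℂ) (l : Fin L) :
    N.A r l (fun k m => q k.1 m) = N.revOmega (N.revCov q r) l := by
  have h1 : ∀ k, ∑ m, (q k m : ℂ) • N.interfMatrix r l k m =
      (N.Φ k l : ℂ) • ((N.H k l)ᴴ * N.revCov q r k * N.H k l) := by
    intro k
    simp only [revCov, interfMatrix, Matrix.mul_sum, Matrix.sum_mul, Matrix.mul_smul,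
      Matrix.smul_mul, Finset.smul_sum]
    exact Finset.sum_congr rfl fun m _ => smul_comm _ _ _
  simp only [A, revOmega, h1]
  congr 1
  rw [← Finset.add_sum_erase _ _ (Finset.mem_univ l), N.Φ_diag, Complex.ofReal_zero, zero_smul,
    zero_add]
  exact (Finset.sum_subtype _ (fun k => by simp)
    (fun k => (N.Φ k l : ℂ) • ((N.H k l)ᴴ * N.revCov q r k * N.H k l))).symm

/-- At the family itself all constraints are tight, so the Lagrangian equals the objective. -/
lemma lagrangian_self (N : BMAC L) (S : N.Cov) (r : ∀ l, Fin (M l) → Fin (N.nR l) → ℂ)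
    (l : Fin L) (lam : Mult M l) (ν : ℝ) : N.lagrangian S r l lam ν (S l) = (S l).trace.re := by
  have h1 : (S l * N.A r l lam).trace.re = (S l).trace.re +
      ∑ k : {k : Fin L // k ≠ l}, ∑ m, lam k m * (S l * N.interfMatrix r l k.1 m).trace.re := by
    simp only [A, Matrix.mul_add, Matrix.mul_one, Matrix.mul_sum, Matrix.mul_smul, trace_add,
      trace_sum, trace_smul, smul_eq_mul, Complex.add_re, Complex.re_sum, Complex.re_ofReal_mul]
  rw [lagrangian, h1, rate]
  ring

lemma dualFunction_le (N : BMAC L) {S : N.Cov} {l : Fin L} (hS : (S l).PosSemidef)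
    (r : ∀ l, Fin (M l) → Fin (N.nR l) → ℂ) (lam : Mult M l) (ν : ℝ) :
    N.dualFunction S r l lam ν ≤ ((S l).trace.re : EReal) := by
  rw [← lagrangian_self N S r l lam ν]
  exact iInf_le (fun X : {X : Matrix (Fin (N.nT l)) (Fin (N.nT l)) ℂ // X.PosSemidef} =>
    (N.lagrangian S r l lam ν X.1 : EReal)) ⟨S l, hS⟩

namespace IsPowerMinimal

variable (hN : N.IsPowerMinimal p t r)
include hN

/-- The reverse SINR equation of stream `m`: the streams of the same link that disturb it on the
reverse link are those decoded before it on the forward link. -/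
lemma sinrCoeff_mul_revPower_eq (l : Fin L) (m : Fin (M l)) :
    N.sinrCoeff p t r ⟨l, m⟩ * N.revPower p t r l m =
      qf (N.revOmega (N.revCov (N.revPower p t r) r) l) (t l m) +
        ∑ n ∈ Finset.Iio m, N.revPower p t r l n * N.gain t r l n l m := by
  set q := N.revPower p t r
  have h1 : ∑ j ∈ Finset.univ.erase l, ∑ n, q j n * N.crossTalk t r ⟨j, n⟩ ⟨l, m⟩ =
      ∑ j ∈ Finset.univ.erase l, ∑ n,
        q j n * (N.Φ j l * ‖star (r j n) ⬝ᵥ (N.H j l *ᵥ t l m)‖ ^ 2) := by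
    refine Finset.sum_congr rfl fun j hj => Finset.sum_congr rfl fun n _ => ?_
    simp only [crossTalk, of_apply, if_neg (Finset.ne_of_mem_erase hj).symm, gain]
  have h2 : ∑ n, q l n * N.crossTalk t r ⟨l, n⟩ ⟨l, m⟩ =
      ∑ n ∈ Finset.Iio m, q l n * N.gain t r l n l m := by
    have : Finset.Iio m = Finset.univ.filter fun i : Fin (M l) => ¬ (m : ℕ) ≤ (i : ℕ) := by
      ext i
      simp only [Finset.mem_Iio, Finset.mem_filter, Finset.mem_univ, true_and, not_le, Fin.lt_def]
    rw [this, Finset.sum_filter]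
    refine Finset.sum_congr rfl fun n _ => ?_
    simp only [crossTalk, of_apply, if_true]
    split_ifs <;> simp
  have h3 : qf 1 (t l m) = 1 := by rw [qf_one, hN.norm_t, one_pow]
  have h4 := hN.sinrCoeff_mul_revPower ⟨l, m⟩
  rw [← Finset.add_sum_erase _ _ (Finset.mem_univ l), h1, h2] at h4
  rw [qf_revOmega, h3, ← Finset.add_sum_erase _ _ (Finset.mem_univ l)]
  simp only [N.Φ_diag, zero_mul, mul_zero, Finset.sum_const_zero, zero_add]
  change N.sinrCoeff p t r ⟨l, m⟩ * q l m = _ at h4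
  rw [h4]
  ring

/-- The reverse interference from stream `n` to stream `m` in terms of the price of `n` and the
Sherman–Morrison decrement of the whitened gain of `m`. -/
lemma revPower_mul_gain (l : Fin L) (n m : Fin (M l)) :
    N.revPower p t r l n * N.gain t r l n l m = N.ratePrice p t r l n *
      (p l n * ‖star (N.H l l *ᵥ t l n) ⬝ᵥ ((N.streamNoise p t l n)⁻¹ *ᵥ (N.H l l *ᵥ t l m))‖ ^ 2 /
        (1 + N.sinr p t r l n)) := by
  obtain ⟨α, h1, h2⟩ := hN.exists_mmse l n
  have hα : ‖α‖ ≠ 0 := norm_ne_zero_iff.mpr (h2 (hN.channel_ne_zero l n)).1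
  have hV := hN.posDef_streamNoise l n
  have hw := (hN.whitenedGain_pos l n).ne'
  have hp := (hN.pos l n).ne'
  have hs : 1 + p l n * N.whitenedGain p t l n ≠ 0 := by
    have := hN.sinr_pos l n
    rw [hN.sinr_eq] at this
    positivity
  have e1 : N.gain t r l n l n = ‖α‖ ^ 2 * N.whitenedGain p t l n ^ 2 := by
    rw [gain, h1, norm_star_mmse_dotProduct_self hV, whitenedGain]
  have e2 : N.gain t r l n l m = ‖α‖ ^ 2 *
      ‖star (N.H l l *ᵥ t l n) ⬝ᵥ ((N.streamNoise p t l n)⁻¹ *ᵥ (N.H l l *ᵥ t l m))‖ ^ 2 := by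
    rw [gain, h1, norm_star_mmse_dotProduct hV]
  rw [ratePrice, e1, e2, hN.sinr_eq]
  field_simp

lemma sinrCoeff_mul_revPower_eq_ratePrice (l : Fin L) (m : Fin (M l)) :
    N.sinrCoeff p t r ⟨l, m⟩ * N.revPower p t r l m =
      N.ratePrice p t r l m * (N.whitenedGain p t l m / (1 + N.sinr p t r l m)) := by
  have hw := (hN.whitenedGain_pos l m).ne'
  have hp := (hN.pos l m).ne'
  have hs : 1 + p l m * N.whitenedGain p t l m ≠ 0 := by
    have := hN.sinr_pos l m
    rw [hN.sinr_eq] at this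
    positivity
  rw [sinrCoeff, ratePrice, hN.sinr_eq]
  field_simp

/-- The whitened gain against everything received, from the telescoped Sherman–Morrison formula. -/
lemma whitenedGain_div (l : Fin L) (m : Fin (M l)) :
    N.whitenedGain p t l m / (1 + N.sinr p t r l m) =
      qf (N.received p t l)⁻¹ (N.H l l *ᵥ t l m) + ∑ n ∈ Finset.Iio m, p l n *
        ‖star (N.H l l *ᵥ t l n) ⬝ᵥ ((N.streamNoise p t l n)⁻¹ *ᵥ (N.H l l *ᵥ t l m))‖ ^ 2 /
          (1 + N.sinr p t r l n) := by
  have h1 := qf_inv_telescope (N.posDef_Omega hN.posSemidef l) (fun m => (hN.pos l m).le)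
    (fun i => N.H l l *ᵥ t l i) (N.H l l *ᵥ t l m) m
  change N.whitenedGain p t l m = qf (N.received p t l)⁻¹ (N.H l l *ᵥ t l m) +
    ∑ n ∈ Finset.Iic m, p l n *
        ‖star (N.H l l *ᵥ t l n) ⬝ᵥ ((N.streamNoise p t l n)⁻¹ *ᵥ (N.H l l *ᵥ t l m))‖ ^ 2 /
          (1 + p l n * N.whitenedGain p t l n) at h1
  simp only [← hN.sinr_eq] at h1
  have h2 : Finset.Iic m = insert m (Finset.Iio m) := by
    ext i; simp [le_iff_eq_or_lt]
  rw [h2, Finset.sum_insert (by simp), dotProduct_mulVec_eq_qf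
    (hN.posDef_streamNoise l m).inv.isHermitian, Complex.norm_real, Real.norm_eq_abs, sq_abs] at h1
  change _ = _ + (p l m * N.whitenedGain p t l m ^ 2 / _ + _) at h1
  have hs : 1 + N.sinr p t r l m ≠ 0 := by have := hN.sinr_pos l m; positivity
  have h3 : N.whitenedGain p t l m / (1 + N.sinr p t r l m) = N.whitenedGain p t l m -
      p l m * N.whitenedGain p t l m ^ 2 / (1 + N.sinr p t r l m) := by
    rw [hN.sinr_eq] at hs ⊢
    rw [eq_sub_iff_add_eq, ← add_div, div_eq_iff hs]
    ring
  rw [h3]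
  linarith

lemma qf_revOmega_stream (l : Fin L) (m : Fin (M l)) :
    qf (N.revOmega (N.revCov (N.revPower p t r) r) l) (t l m) =
      N.ratePrice p t r l m * (N.whitenedGain p t l m / (1 + N.sinr p t r l m)) -
      ∑ n ∈ Finset.Iio m, N.ratePrice p t r l n * (p l n *
        ‖star (N.H l l *ᵥ t l n) ⬝ᵥ ((N.streamNoise p t l n)⁻¹ *ᵥ (N.H l l *ᵥ t l m))‖ ^ 2 /
          (1 + N.sinr p t r l n)) := by
  rw [← hN.sinrCoeff_mul_revPower_eq_ratePrice, hN.sinrCoeff_mul_revPower_eq]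
  simp only [hN.revPower_mul_gain]
  ring

/-- All streams of a link have the same price `ν` of rate, and `ν` satisfies the optimality
conditions of the link: `ν H†(Ω + H Σ H†)⁻¹ H ≤ Ω̂`, with equality on the beams in use. -/
lemma exists_price (l : Fin L) : ∃ ν : ℝ, 0 ≤ ν ∧ (∀ m, N.ratePrice p t r l m = ν) ∧
    (∀ x, ν * qf (N.received p t l)⁻¹ (N.H l l *ᵥ x) ≤
      qf (N.revOmega (N.revCov (N.revPower p t r) r) l) x) ∧
    ∀ m, ν * qf (N.received p t l)⁻¹ (N.H l l *ᵥ t l m) =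
      qf (N.revOmega (N.revCov (N.revPower p t r) r) l) (t l m) := by
  rcases isEmpty_or_nonempty (Fin (M l)) with hM | hM
  · refine ⟨0, le_rfl, fun m => hM.elim m, fun x => ?_, fun m => hM.elim m⟩
    rw [zero_mul, qf_revOmega]
    exact add_nonneg (qf_nonneg PosSemidef.one x) (Finset.sum_nonneg fun k _ =>
      Finset.sum_nonneg fun n _ => mul_nonneg (hN.revPower_nonneg k n)
        (mul_nonneg (N.Φ_nonneg _ _) (sq_nonneg _)))
  obtain ⟨m₀, hm₀⟩ := Finite.exists_max (N.ratePrice p t r l)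
  have hle : ∀ x, N.ratePrice p t r l m₀ * qf (N.received p t l)⁻¹ (N.H l l *ᵥ x) ≤
      qf (N.revOmega (N.revCov (N.revPower p t r) r) l) x := fun x => by
    rw [qf_revOmega]; exact hN.ratePrice_mul_le l m₀ x
  -- By induction on the decoding order, the bound for the largest price leaves no room for smaller
  -- ones.
  have heq : ∀ m, N.ratePrice p t r l m = N.ratePrice p t r l m₀ := by
    intro m
    induction m using WellFoundedLT.induction with
    | ind m ih =>
      refine le_antisymm (hm₀ m) ?_
      have h1 := hle (t l m)
      rw [hN.qf_revOmega_stream, Finset.sum_congr rfl fun n hn => by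
        rw [ih n (Finset.mem_Iio.mp hn)], ← Finset.mul_sum] at h1
      have h2 := hN.whitenedGain_div l m
      have h3 : 0 < N.whitenedGain p t l m / (1 + N.sinr p t r l m) :=
        div_pos (hN.whitenedGain_pos l m) (by have := hN.sinr_pos l m; positivity)
      refine le_of_mul_le_mul_right ?_ h3
      nth_rewrite 1 [h2]
      rw [mul_add]
      linarith
  refine ⟨N.ratePrice p t r l m₀, ?_, heq, hle, fun m => ?_⟩
  · have h1 := hN.revPower_nonneg l m₀
    have h2 := hN.pos l m₀
    have h3 := hN.sinr_pos l m₀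
    have h4 := hN.gain_pos l m₀
    rw [ratePrice]
    positivity
  · rw [hN.qf_revOmega_stream, hN.whitenedGain_div]
    simp only [heq, ← Finset.mul_sum]
    ring

/-- The covariance of the link minimizes the Lagrangian, by concavity of `logDet`. -/
lemma trace_le_lagrangian (l : Fin L) {ν : ℝ} (hν : 0 ≤ ν)
    (hle : ∀ x, ν * qf (N.received p t l)⁻¹ (N.H l l *ᵥ x) ≤
      qf (N.revOmega (N.revCov (N.revPower p t r) r) l) x)
    (heq : ∀ m, ν * qf (N.received p t l)⁻¹ (N.H l l *ᵥ t l m) =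
      qf (N.revOmega (N.revCov (N.revPower p t r) r) l) (t l m))
    {X : Matrix (Fin (N.nT l)) (Fin (N.nT l)) ℂ} (hX : X.PosSemidef) :
    (N.cov p t l).trace.re ≤
      N.lagrangian (N.cov p t) r l (fun k m => N.revPower p t r k.1 m) ν X := by
  set S := N.cov p t with hS
  set K := (N.H l l)ᴴ * (N.received p t l)⁻¹ * N.H l l with hK
  set G := N.revOmega (N.revCov (N.revPower p t r) r) l - (ν : ℂ) • K with hG
  have hqG : ∀ x, qf G x = qf (N.revOmega (N.revCov (N.revPower p t r) r) l) x -
      ν * qf (N.received p t l)⁻¹ (N.H l l *ᵥ x) := fun x => by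
    rw [hG, qf_sub, qf_smul, hK, qf_conj]
  have hXG : 0 ≤ (X * G).trace.re := trace_mul_re_nonneg hX fun x => by
    rw [hqG]; linarith [hle x]
  have hSG : (S l * G).trace.re = 0 := by
    rw [hS, cov, Matrix.sum_mul, trace_sum, Complex.re_sum]
    refine Finset.sum_eq_zero fun m _ => ?_
    rw [Matrix.smul_mul, trace_smul, smul_eq_mul, Complex.re_ofReal_mul, trace_vecMulVec_mul_re,
      hqG, ← heq, sub_self, mul_zero]
  have hW := N.posDef_Omega hN.posSemidef l
  have hrec : N.received p t l = N.Omega S l + N.H l l * S l * (N.H l l)ᴴ := by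
    rw [received, hS, cov, conj_streams]
  have hlog : N.linkRate l X (N.Omega S l) ≤ N.rate S l + ((X - S l) * K).trace.re := by
    rw [rate, N.linkRate_eq l hX hW, N.linkRate_eq l (hN.posSemidef l) hW, ← hrec]
    have h1 := logDet_le_add_trace (hW.add_posSemidef (hX.mul_mul_conjTranspose_same (N.H l l)))
      (hN.posDef_received l)
    have h2 : ((N.Omega S l + N.H l l * X * (N.H l l)ᴴ - N.received p t l) *
        (N.received p t l)⁻¹).trace = ((X - S l) * K).trace := by
      have h3 : N.Omega S l + N.H l l * X * (N.H l l)ᴴ - N.received p t l =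
          N.H l l * ((X - S l) * (N.H l l)ᴴ) := by
        rw [hrec, add_sub_add_left_eq_sub, ← Matrix.mul_assoc, ← Matrix.sub_mul, ← Matrix.mul_sub]
      rw [h3, hK, Matrix.mul_assoc, trace_mul_comm]
      simp only [Matrix.mul_assoc]
    rw [h2] at h1
    linarith
  have h1 : ∀ Y : Matrix (Fin (N.nT l)) (Fin (N.nT l)) ℂ, (Y * G).trace.re =
      (Y * N.A r l fun k m => N.revPower p t r k.1 m).trace.re - ν * (Y * K).trace.re := fun Y => by
    rw [A_eq_revOmega, hG, Matrix.mul_sub, Matrix.mul_smul, trace_sub, trace_smul, smul_eq_mul,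
      Complex.sub_re, Complex.re_ofReal_mul]
  rw [h1] at hXG hSG
  rw [Matrix.sub_mul, trace_sub, Complex.sub_re] at hlog
  rw [← lagrangian_self N S r l (fun k m => N.revPower p t r k.1 m) ν, lagrangian, lagrangian]
  have h2 := mul_le_mul_of_nonneg_left hlog hν
  rw [rate] at h2 ⊢
  linarith

end IsPowerMinimal

end Duality

end BMAC

theorem mainTheorem3 {L : ℕ} (N : BMAC L) (P : ℝ) (M : Fin L → ℕ)
    (p : ∀ l, Fin (M l) → ℝ) (t : ∀ l, Fin (M l) → Fin (N.nT l) → ℂ)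
    (r : ∀ l, Fin (M l) → Fin (N.nR l) → ℂ) (q : ∀ l, Fin (M l) → ℝ)
    (hp : ∀ l m, 0 < p l m)
    (ht : ∀ l m, ‖WithLp.toLp 2 (t l m)‖ = 1)
    (hpareto : N.IsParetoOptimal P (N.cov p t))
    (hrate : ∃ l, 0 < N.rate (N.cov p t) l)
    (hr : N.IsMMSEReceiver p t r)
    (hq : q = N.revPower p t r)
    (l : Fin L) :
    (N.cov p t l ∈ N.feasible (N.cov p t) r l ∧
      ∀ X ∈ N.feasible (N.cov p t) r l, (N.cov p t l).trace.re ≤ X.trace.re) ∧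
    (∃ ν : ℝ,
      (∀ m : Fin (M l), ν = q l m * p l m * (1 + N.sinr p t r l m) * N.gain t r l m l m /
        N.sinr p t r l m ^ 2) ∧
      N.IsOptimalDual (N.cov p t) r l (fun k m => q k.1 m) ν ∧
      N.dualFunction (N.cov p t) r l (fun k m => q k.1 m) ν =
        ((N.cov p t l).trace.re : EReal)) ∧
    N.A r l (fun k m => q k.1 m) = N.revOmega (N.revCov q r) l := by
  subst hq
  have hN := BMAC.IsParetoOptimal.isPowerMinimal hp ht hpareto hrate hr
  have hS := hN.posSemidef l
  refine ⟨⟨⟨hS, le_rfl, fun _ _ => le_rfl⟩, fun X hX => hN.trace_le_of_mem_feasible l hX⟩, ?_,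
    BMAC.A_eq_revOmega N _ r l⟩
  obtain ⟨ν, hν, hprice, hle, heq⟩ := hN.exists_price l
  have hdual : N.dualFunction (N.cov p t) r l (fun k m => N.revPower p t r k.1 m) ν =
      ((N.cov p t l).trace.re : EReal) :=
    le_antisymm (N.dualFunction_le hS r _ ν) (le_iInf fun X =>
      EReal.coe_le_coe_iff.mpr (hN.trace_le_lagrangian l hν hle heq X.2))
  refine ⟨ν, fun m => (hprice m).symm, ⟨fun k m => hN.revPower_nonneg k.1 m, hν,
    fun lam' ν' _ _ => ?_⟩, hdual⟩
  rw [hdual]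
  exact N.dualFunction_le hS r lam' ν'
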